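/- Let $R$ be an associative ring with identity; modules are left $R$-modules and complexes are cochain complexes of $R$-modules indexed by $\mathbb Z$. **Conventions.** A short exact sequence is *pure exact* if it stays exact after applying $M\otimes_R-$ for every right $R$-module $M$; its maps are then called *pure monic* and *pure epic*. A module is *pure injective* if it is injective with respect to pure exact sequences. A complex $X$ is *pure exact at $n$* if each of $d_X^{n-1}$ and $d_X^n$ is a pure epic followed by a pure monic and $0\to \operatorname{Ker} d_X^n\to X^n\to \operatorname{Coker} d_X^{n-1}\to 0$ is pure exact; it is *pure exact* if this holds for all $n$. A cochain map is a *pure quasi-isomorphism* if its mapping cone is pure exact. The objects of the pure derived category $\mathbf D_{\mathrm{pur}}(R)$ are all complexes, and two complexes are isomorphic in it if they are joined by a roof $\bullet\leftarrow\bullet\to\bullet$ of pure quasi-isomorphisms; $\mathbf D^b_{\mathrm{pur}}(R)$ consists of the complexes isomorphic in $\mathbf D_{\mathrm{pur}}(R)$ to a bounded complex. Let $\inf_p X$ and $\sup_p X$ be the infimum and supremum, in $\mathbb Z\cup\{\pm\infty\}$, of $\{n\in\mathbb Z : X \text{ is not pure exact at } n\}$ (so $\inf_pX=\infty$, $\sup_pX=-\infty$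 if $X$ is pure exact). A *pure injective resolution* of $Y$ is a pure quasi-isomorphism $Y\to I$ with $I$ a complex of pure injective modules such that the total complex functor $\operatorname{Hom}_R(-,I)$ takes pure exact complexes to pure exact complexes (of $\mathbb Z$-modules). We write $\operatorname{pid}_RY\le n$ if $Y$ has a pure injective resolution $Y\to I$ with $I^i=0$ for all $i>n$. For $Y\in\mathbf D^b_{\mathrm{pur}}(R)$, any complex $X$ and $i\in\mathbb Z$, put $\operatorname{Pext}^i_R(X,Y)=H^i\operatorname{Hom}_R(X,I)$, where $Y\to I$ is a pure injective resolution. A module is regarded as a complex concentrated in degree $0$; a complex is *contractible* if its identity map is homotopic to zero. **Theorem.** Let $Y\in\mathbf D^b_{\mathrm{pur}}(R)$ and $n\in\mathbb Z$. The following are equivalent. 1. $\operatorname{pid}_RY\le n$. 2. $\sup_pY\le n$, and for every pure injective resolution $Y\to I'$ the module $\operatorname{Ker} d_{I'}^n$ is pure injective. 3. For every pure injective resolution $Y\to I'$ there is an isomorphism of complexes $I'\cong I_1\oplus I_2$ with $I_1^i=0$ for all $i>n$ and $I_2$ contractible. 4. $\operatorname{Pext}^i_R(X,Y)=0$ for every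 $X\in\mathbf D_{\mathrm{pur}}(R)$ and every integer $i>n-\inf_pX$. 5. $\sup_pY\le n$, and $\operatorname{Pext}^{n+1}_R(M,Y)=0$ for every $R$-module $M$. -/

import Mathlib

open CategoryTheory CategoryTheory.Limits

noncomputable section

namespace PureDerived

universe w v

section Purity

variable (R : Type w) [Ring R]

/-- The relations `(m r) ⊗ a - m ⊗ (r a)` that cut the tensor product `M ⊗_R A` of a right module
and a left module over a (not necessarily commutative) ring out of `M ⊗_ℤ A`.  A right `R`-module
is a module over the opposite ring. -/
def balanced (M : Type v) [AddCommGroup M] [Module Rᵐᵒᵖ M] (A : Type v) [AddCommGroup A]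
    [Module R A] : Submodule ℤ (TensorProduct ℤ M A) :=
  Submodule.span ℤ {t | ∃ (m : M) (r : R) (a : A),
    t = TensorProduct.tmul ℤ (MulOpposite.op r • m) a - TensorProduct.tmul ℤ m (r • a)}

/-- The abelian group `M ⊗_R A` for a right `R`-module `M` and a left `R`-module `A`. -/
abbrev RTensor (M : Type v) [AddCommGroup M] [Module Rᵐᵒᵖ M] (A : Type v) [AddCommGroup A]
    [Module R A] : Type v :=
  TensorProduct ℤ M A ⧸ balanced R M A

variable {R}

theorem balanced_le_comap (M : Type v) [AddCommGroup M] [Module Rᵐᵒᵖ M] {A B : Type v}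
    [AddCommGroup A] [Module R A] [AddCommGroup B] [Module R B] (f : A →ₗ[R] B) :
    balanced R M A ≤
      (balanced R M B).comap (LinearMap.lTensor M f.toAddMonoidHom.toIntLinearMap) := by
  refine Submodule.span_le.2 ?_
  rintro _ ⟨m, r, a, rfl⟩
  refine Submodule.subset_span ⟨m, r, f a, ?_⟩
  simp

/-- The map `M ⊗_R f : M ⊗_R A → M ⊗_R B` induced by an `R`-linear map `f : A → B`. -/
def RTensor.map (M : Type v) [AddCommGroup M] [Module Rᵐᵒᵖ M] {A B : Type v}
    [AddCommGroup A] [Module R A] [AddCommGroup B] [Module R B] (f : A →ₗ[R] B) :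
    RTensor R M A →ₗ[ℤ] RTensor R M B :=
  Submodule.mapQ _ _ (LinearMap.lTensor M f.toAddMonoidHom.toIntLinearMap)
    (balanced_le_comap M f)

/-- `0 → A → B → C → 0` is a pure exact sequence of left `R`-modules: it is short exact and stays
short exact after applying `M ⊗_R -` for every right `R`-module `M`. -/
structure PureShortExact {A B C : Type v} [AddCommGroup A] [Module R A] [AddCommGroup B]
    [Module R B] [AddCommGroup C] [Module R C] (f : A →ₗ[R] B) (g : B →ₗ[R] C) : Prop where
  injective : Function.Injective f
  exact : Function.Exact f g
  surjective : Function.Surjective g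
  tensor_injective : ∀ (M : Type v) [AddCommGroup M] [Module Rᵐᵒᵖ M],
    Function.Injective (RTensor.map M f)
  tensor_exact : ∀ (M : Type v) [AddCommGroup M] [Module Rᵐᵒᵖ M],
    Function.Exact (RTensor.map M f) (RTensor.map M g)
  tensor_surjective : ∀ (M : Type v) [AddCommGroup M] [Module Rᵐᵒᵖ M],
    Function.Surjective (RTensor.map M g)

/-- `f` is pure monic: it is the first map of a pure exact sequence (with its cokernel). -/
def PureMono {A B : Type v} [AddCommGroup A] [Module R A] [AddCommGroup B] [Module R B]
    (f : A →ₗ[R] B) : Prop :=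
  PureShortExact f (LinearMap.range f).mkQ

/-- `g` is pure epic: it is the second map of a pure exact sequence (with its kernel). -/
def PureEpi {B C : Type v} [AddCommGroup B] [Module R B] [AddCommGroup C] [Module R C]
    (g : B →ₗ[R] C) : Prop :=
  PureShortExact (LinearMap.ker g).subtype g

variable (R) in
/-- `E` is pure injective: it is injective with respect to pure exact sequences. -/
def PureInjective (E : Type v) [AddCommGroup E] [Module R E] : Prop :=
  ∀ (A B C : Type v) [AddCommGroup A] [Module R A] [AddCommGroup B] [Module R B]
    [AddCommGroup C] [Module R C] (f : A →ₗ[R] B) (g : B →ₗ[R] C), PureShortExact f g →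
    ∀ h : A →ₗ[R] E, ∃ k : B →ₗ[R] E, k ∘ₗ f = h

end Purity

section Complexes

variable {R : Type w} [Ring R]

/-- A homomorphism decomposes as a pure epic followed by a pure monic. -/
def Decomposes {A B : ModuleCat.{v} R} (d : A ⟶ B) : Prop :=
  ∃ (D : ModuleCat.{v} R) (p : A →ₗ[R] D) (j : D →ₗ[R] B),
    PureEpi p ∧ PureMono j ∧ j ∘ₗ p = d.hom

/-- The complex `X` is pure exact at `n`: the differentials `d^{n-1}` and `d^n` decompose as a pure
epic followed by a pure monic, and `0 → Ker d^n → X^n → Coker d^{n-1} → 0` is pure exact. -/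
def PureExactAt (X : CochainComplex (ModuleCat.{v} R) ℤ) (n : ℤ) : Prop :=
  Decomposes (X.d (n - 1) n) ∧ Decomposes (X.d n (n + 1)) ∧
    PureShortExact (LinearMap.ker (X.d n (n + 1)).hom).subtype
      (LinearMap.range (X.d (n - 1) n).hom).mkQ

/-- A complex is pure exact if it is pure exact at every `n`. -/
def PureExact (X : CochainComplex (ModuleCat.{v} R) ℤ) : Prop :=
  ∀ n : ℤ, PureExactAt X n

/-- A cochain map is a pure quasi-isomorphism if its mapping cone is pure exact. -/
def PureQuasiIso {X Y : CochainComplex (ModuleCat.{v} R) ℤ} (f : X ⟶ Y) : Prop :=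
  PureExact (CochainComplex.mappingCone f)

/-- `X` and `Y` are isomorphic in the pure derived category: they are connected by a roof
`X ← Z → Y` of pure quasi-isomorphisms. -/
def IsoInDpur (X Y : CochainComplex (ModuleCat.{v} R) ℤ) : Prop :=
  ∃ (Z : CochainComplex (ModuleCat.{v} R) ℤ) (s : Z ⟶ X) (a : Z ⟶ Y),
    PureQuasiIso s ∧ PureQuasiIso a

/-- `X^i = 0` for `|i|` large. -/
def IsBounded (X : CochainComplex (ModuleCat.{v} R) ℤ) : Prop :=
  ∃ a b : ℤ, ∀ i : ℤ, i < a ∨ b < i → IsZero (X.X i)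

/-- `X` lies in the bounded pure derived category, as a full subcategory (closed under
isomorphisms) of the pure derived category, whose objects are all complexes. -/
def InDbpur (X : CochainComplex (ModuleCat.{v} R) ℤ) : Prop :=
  ∃ B : CochainComplex (ModuleCat.{v} R) ℤ, IsBounded B ∧ IsoInDpur X B

/-- An integer as an extended real. -/
abbrev ext (n : ℤ) : EReal := ((n : ℝ) : EReal)

/-- `inf_p X`, the infimum of the `n` at which `X` is not pure exact (so `⊤` if there is none and
`⊥` if these `n` are not bounded below). -/
def infp (X : CochainComplex (ModuleCat.{v} R) ℤ) : EReal :=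
  sInf (ext '' {n : ℤ | ¬ PureExactAt X n})

/-- `sup_p X`, the supremum of the `n` at which `X` is not pure exact (so `⊥` if there is none and
`⊤` if these `n` are not bounded above). -/
def supp (X : CochainComplex (ModuleCat.{v} R) ℤ) : EReal :=
  sSup (ext '' {n : ℤ | ¬ PureExactAt X n})

/-- The total Hom complex `Hom_R(X, Y)`, as a complex of `ℤ`-modules: `∏ᵢ Hom(X^i, Y^{i+n})` in
degree `n`, with `d φ = d_Y φ - (-1)^n φ d_X`. -/
def homComplex (X Y : CochainComplex (ModuleCat.{v} R) ℤ) :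
    CochainComplex (ModuleCat.{v} ℤ) ℤ where
  X n := ModuleCat.of ℤ (CochainComplex.HomComplex.Cochain X Y n)
  d n m := ModuleCat.ofHom (CochainComplex.HomComplex.δ_hom ℤ X Y n m)
  shape n m h := by
    refine ModuleCat.hom_ext (LinearMap.ext fun z => ?_)
    exact CochainComplex.HomComplex.δ_shape n m h z
  d_comp_d' n m k _ _ := by
    refine ModuleCat.hom_ext (LinearMap.ext fun z => ?_)
    exact CochainComplex.HomComplex.δ_δ n m k z

/-- `f : Y ⟶ I` is a pure injective resolution of `Y`: a pure quasi-isomorphism to a complex of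
pure injective modules such that `Hom_R(-, I)` preserves pure exact complexes. -/
structure IsPureInjectiveResolution {Y I : CochainComplex (ModuleCat.{v} R) ℤ} (f : Y ⟶ I) :
    Prop where
  pureQuasiIso : PureQuasiIso f
  pureInjective : ∀ i : ℤ, PureInjective R (I.X i)
  hom_preserves : ∀ X : CochainComplex (ModuleCat.{v} R) ℤ, PureExact X →
    PureExact (homComplex X I)

/-- There is a pure injective resolution `Y ⟶ I` with `I^i = 0` for all `i > m`. -/
def HasResolutionUpTo (Y : CochainComplex (ModuleCat.{v} R) ℤ) (m : ℤ) : Prop :=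
  ∃ (I : CochainComplex (ModuleCat.{v} R) ℤ) (f : Y ⟶ I), IsPureInjectiveResolution f ∧
    ∀ i : ℤ, m < i → IsZero (I.X i)

/-- The pure injective dimension of `Y`: the least `m` such that `Y` has a pure injective
resolution vanishing in degrees `> m`; it is `⊥` if every `m` will do and `⊤` if none will. -/
def pid (Y : CochainComplex (ModuleCat.{v} R) ℤ) : EReal :=
  sInf (ext '' {m : ℤ | HasResolutionUpTo Y m})

open Classical in
/-- A chosen pure injective resolution of `Y` (and `Y` itself if there is none; every complex in
the bounded pure derived category has one). -/
def chosenResolution (Y : CochainComplex (ModuleCat.{v} R) ℤ) :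
    CochainComplex (ModuleCat.{v} R) ℤ :=
  if h : ∃ (I : CochainComplex (ModuleCat.{v} R) ℤ) (f : Y ⟶ I), IsPureInjectiveResolution f
  then h.choose else Y

/-- The right pure derived functor of Hom, `RHom_R(X, Y) = Hom_R(X, I)` with `Y ⟶ I` a pure
injective resolution. -/
def RHom (X Y : CochainComplex (ModuleCat.{v} R) ℤ) : CochainComplex (ModuleCat.{v} ℤ) ℤ :=
  homComplex X (chosenResolution Y)

/-- `Pext^i_R(X, Y) = H^i RHom_R(X, Y)`. -/
def Pext (i : ℤ) (X Y : CochainComplex (ModuleCat.{v} R) ℤ) : ModuleCat.{v} ℤ :=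
  (RHom X Y).homology i

/-- A module as a complex concentrated in degree `0`. -/
abbrev stalk (M : ModuleCat.{v} R) : CochainComplex (ModuleCat.{v} R) ℤ :=
  (HomologicalComplex.single (ModuleCat.{v} R) (ComplexShape.up ℤ) 0).obj M

/-- A complex is contractible if its identity map is homotopic to zero. -/
def Contractible (X : CochainComplex (ModuleCat.{v} R) ℤ) : Prop :=
  Nonempty (Homotopy (𝟙 X) 0)

end Complexes

end PureDerived

end

universe u

/-!
Pure exactness of a complex is tested by `Hom(-, E)` for the pure injective modules `E`. Hence the
pure exact complexes form a left orthogonal in the homotopy category, pure injective resolutions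
`Y → I` are unique up to homotopy equivalence, and pure exactness above `n` passes between `Y` and
`I`. Everything is read off one homotopy invariant condition on `I`: for `j > n` the differential
`I^{j-1} → Z^j` onto the cycles is a split epimorphism. It says that `I` is contractible above `n`
(so `I` is the sum of a complex vanishing above `n` and a contractible one), it follows from
`Pext^j(Z^j, Y) = 0`, and for `I` pure exact above `n` it follows from pure injectivity of `Z^n`.
When `I` vanishes above `n`, `Pext^i(X, Y) = 0` is obtained by replacing `X` with its truncation
in degrees `> n - i`.
-/

universe w v

noncomputable section

namespace PureDerived

theorem intTensor_addHom_ext {M N P : Type*} [AddCommGroup M] [AddCommGroup N] [AddCommGroup P]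
    {f g : TensorProduct ℤ M N →+ P}
    (h : ∀ m n, f (TensorProduct.tmul ℤ m n) = g (TensorProduct.tmul ℤ m n)) : f = g :=
  congrArg LinearMap.toAddMonoidHom
    (TensorProduct.ext' (g := f.toIntLinearMap) (h := g.toIntLinearMap) h)

section Duality

variable {R : Type w} [Ring R]

/-- The character module of a left module, as a right module. -/
local instance {A : Type v} [AddCommGroup A] [Module R A] : Module Rᵐᵒᵖ (CharacterModule A) :=
  inferInstanceAs (Module Rᵈᵐᵃ (A →+ AddCircle (1 : ℚ)))

/-- The character module of a right module, as a left module. -/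
local instance {N : Type v} [AddCommGroup N] [Module Rᵐᵒᵖ N] : Module R (CharacterModule N) :=
  Module.compHom _ (RingEquiv.opOp R).toRingHom

variable {N : Type v} [AddCommGroup N] [Module Rᵐᵒᵖ N]
  {A B C : Type v} [AddCommGroup A] [Module R A] [AddCommGroup B] [Module R B]
  [AddCommGroup C] [Module R C]

/-- The character `n ⊗ a ↦ φ a n` of `N ⊗_R A` adjoint to `φ : A → Hom_ℤ(N, ℚ / ℤ)`. -/
def characterOfHom (φ : A →ₗ[R] CharacterModule N) : CharacterModule (RTensor R N A) :=
  (Submodule.liftQ (balanced R N A)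
    (TensorProduct.lift (LinearMap.mk₂ ℤ (fun n a => φ a n) (fun n n' a => map_add (φ a) n n')
      (fun k n a => map_zsmul (φ a) k n) (fun n a b => congr($(map_add φ a b) n))
      (fun k n a => congr($(map_zsmul φ k a) n))))
    (Submodule.span_le.2 (by
      rintro _ ⟨n, r, a, rfl⟩
      exact (map_sub (TensorProduct.lift _) _ _).trans
        (sub_eq_zero.2 congr($(φ.map_smul r a) n).symm)))).toAddMonoidHom

/-- The tensor-hom adjunction between `N ⊗_R -` and the character module. -/
def homCharacterModuleEquiv :
    (A →ₗ[R] CharacterModule N) ≃ CharacterModule (RTensor R N A) where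
  toFun := characterOfHom
  invFun χ :=
    { toFun a := AddMonoidHom.comp χ
        (((TensorProduct.mk ℤ N A).compr₂ (balanced R N A).mkQ).flip a).toAddMonoidHom
      map_add' a b := DFunLike.ext _ _ fun n =>
        (congrArg (χ ∘ (balanced R N A).mkQ) (TensorProduct.tmul_add n a b)).trans
          (map_add χ (Submodule.Quotient.mk _) (Submodule.Quotient.mk _))
      map_smul' r a := DFunLike.ext _ _ fun n => congrArg χ (Eq.symm <|
        (Submodule.Quotient.eq (balanced R N A)).2 (Submodule.subset_span ⟨n, r, a, rfl⟩)) }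
  left_inv _ := rfl
  right_inv χ := DFunLike.ext _ _ fun t => by
    obtain ⟨t, rfl⟩ := Submodule.mkQ_surjective _ t
    let mk := (balanced R N A).mkQ.toAddMonoidHom
    exact DFunLike.congr_fun (intTensor_addHom_ext (f := AddMonoidHom.comp (characterOfHom _) mk)
      (g := AddMonoidHom.comp χ mk) fun _ _ => rfl) t

theorem RTensor.map_injective_iff {f : A →ₗ[R] B} :
    Function.Injective (RTensor.map N f) ↔
      ∀ φ : A →ₗ[R] CharacterModule N, ∃ ψ : B →ₗ[R] CharacterModule N, ψ ∘ₗ f = φ := by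
  have naturality (χ : CharacterModule (RTensor R N B)) :
      homCharacterModuleEquiv.symm (CharacterModule.dual (RTensor.map N f) χ) =
        homCharacterModuleEquiv.symm χ ∘ₗ f := LinearMap.ext fun _ => rfl
  rw [← CharacterModule.dual_surjective_iff_injective]
  refine ⟨fun h φ => ?_, fun h χ => ?_⟩
  · obtain ⟨χ, hχ⟩ := h (homCharacterModuleEquiv φ)
    exact ⟨_, (naturality χ).symm.trans (homCharacterModuleEquiv.symm_apply_eq.2 hχ)⟩
  · obtain ⟨ψ, hψ⟩ := h (homCharacterModuleEquiv.symm χ)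
    refine ⟨homCharacterModuleEquiv ψ, homCharacterModuleEquiv.symm.injective ?_⟩
    rw [naturality, Equiv.symm_apply_apply, hψ]

theorem balanced_le_map_lTensor {g : B →ₗ[R] C} (hg : Function.Surjective g) :
    balanced R N C ≤
      (balanced R N B).map (LinearMap.lTensor N g.toAddMonoidHom.toIntLinearMap) := by
  refine Submodule.span_le.2 ?_
  rintro _ ⟨n, r, c, rfl⟩
  obtain ⟨b, rfl⟩ := hg c
  refine ⟨_, Submodule.subset_span ⟨n, r, b, rfl⟩, ?_⟩
  simp only [map_sub, LinearMap.lTensor_tmul, AddMonoidHom.coe_toIntLinearMap,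
    LinearMap.toAddMonoidHom_coe, map_smul]

theorem RTensor.map_surjective {g : B →ₗ[R] C} (hg : Function.Surjective g) :
    Function.Surjective (RTensor.map N g) := by
  refine Function.Surjective.of_comp (g := (balanced R N B).mkQ) ?_
  exact (Submodule.mkQ_surjective (balanced R N C)).comp
    (LinearMap.lTensor_surjective N (g := g.toAddMonoidHom.toIntLinearMap) hg)

theorem RTensor.map_exact {f : A →ₗ[R] B} {g : B →ₗ[R] C} (h : Function.Exact f g)
    (hg : Function.Surjective g) : Function.Exact (RTensor.map N f) (RTensor.map N g) := by
  have exact : Function.Exact (LinearMap.lTensor N f.toAddMonoidHom.toIntLinearMap)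
      (LinearMap.lTensor N g.toAddMonoidHom.toIntLinearMap) :=
    lTensor_exact N (f := f.toAddMonoidHom.toIntLinearMap)
      (g := g.toAddMonoidHom.toIntLinearMap) h hg
  intro t
  obtain ⟨t, rfl⟩ := Submodule.mkQ_surjective _ t
  constructor
  · intro ht
    obtain ⟨s, hs, hst⟩ := balanced_le_map_lTensor hg ((Submodule.Quotient.mk_eq_zero _).1 ht)
    obtain ⟨a, ha⟩ := (exact (t - s)).1 ((map_sub _ _ _).trans (sub_eq_zero.2 hst.symm))
    refine ⟨(balanced R N A).mkQ a, ?_⟩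
    change (balanced R N B).mkQ (LinearMap.lTensor N f.toAddMonoidHom.toIntLinearMap a) = _
    rw [ha, map_sub, sub_eq_self]
    exact (Submodule.Quotient.mk_eq_zero _).2 hs
  · rintro ⟨s, hs⟩
    obtain ⟨s, rfl⟩ := Submodule.mkQ_surjective _ s
    rw [← hs]
    exact congrArg (balanced R N C).mkQ (exact.apply_apply_eq_zero s)

theorem pureInjective_characterModule : PureInjective R (CharacterModule N) :=
  fun _ _ _ _ _ _ _ _ _ _ _ hfg => RTensor.map_injective_iff.1 (hfg.tensor_injective N)

variable (R A) in
/-- The evaluation map from a module to its double character module. -/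
def evalDual : A →ₗ[R] CharacterModule (CharacterModule A) where
  toFun a := AddMonoidHom.mk' (fun c : CharacterModule A => c a) fun _ _ => rfl
  map_add' a b := DFunLike.ext _ _ fun c => map_add c a b
  map_smul' _ _ := rfl

theorem evalDual_injective : Function.Injective (evalDual R A) :=
  (injective_iff_map_eq_zero _).2 fun _ ha =>
    CharacterModule.eq_zero_of_character_apply fun c => congr($ha c)

theorem exists_comp_evalDual_eq (φ : A →ₗ[R] CharacterModule N) :
    ∃ ψ : CharacterModule (CharacterModule A) →ₗ[R] CharacterModule N,
      ψ ∘ₗ evalDual R A = φ := by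
  let φ' : N →ₗ[Rᵐᵒᵖ] CharacterModule A :=
    { toFun n := AddMonoidHom.mk' (fun a => φ a n) fun a b => congr($(map_add φ a b) n)
      map_add' n n' := DFunLike.ext _ _ fun a => map_add (φ a) n n'
      map_smul' r n := DFunLike.ext _ _ fun a => congr($(φ.map_smul r.unop a) n).symm }
  exact ⟨{ toFun c := AddMonoidHom.comp c φ'.toAddMonoidHom
           map_add' _ _ := rfl
           map_smul' r c := DFunLike.ext _ _ fun n =>
             congrArg c (φ'.map_smul (MulOpposite.op r) n).symm }, rfl⟩

theorem PureShortExact.of_exists_extension {f : A →ₗ[R] B} {g : B →ₗ[R] C}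
    (h : Function.Exact f g) (hg : Function.Surjective g)
    (ext : ∀ (N : Type v) [AddCommGroup N] [Module Rᵐᵒᵖ N] (φ : A →ₗ[R] CharacterModule N),
      ∃ ψ : B →ₗ[R] CharacterModule N, ψ ∘ₗ f = φ) : PureShortExact f g where
  injective := by
    obtain ⟨ψ, hψ⟩ := ext _ (evalDual R A)
    have : Function.Injective (ψ ∘ f) := by
      rw [← LinearMap.coe_comp, hψ]
      exact evalDual_injective
    exact this.of_comp
  exact := h
  surjective := hg
  tensor_injective N _ _ := RTensor.map_injective_iff.2 (ext N)
  tensor_exact _ _ _ := RTensor.map_exact h hg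
  tensor_surjective _ _ _ := RTensor.map_surjective hg

theorem PureMono.exists_extension {f : A →ₗ[R] B} (hf : PureMono f) {E : Type v} [AddCommGroup E]
    [Module R E] (hE : PureInjective R E) (φ : A →ₗ[R] E) : ∃ ψ : B →ₗ[R] E, ψ ∘ₗ f = φ :=
  hE _ _ _ _ _ hf φ

theorem PureMono.pureShortExact {f : A →ₗ[R] B} (hf : PureMono f) {g : B →ₗ[R] C}
    (h : Function.Exact f g) (hg : Function.Surjective g) : PureShortExact f g :=
  .of_exists_extension h hg fun _ _ _ => hf.exists_extension pureInjective_characterModule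

theorem pureMono_of_exists_extension {f : A →ₗ[R] B}
    (ext : ∀ (E : Type v) [AddCommGroup E] [Module R E], PureInjective R E →
      ∀ φ : A →ₗ[R] E, ∃ ψ : B →ₗ[R] E, ψ ∘ₗ f = φ) : PureMono f :=
  .of_exists_extension (LinearMap.exact_map_mkQ_range _) (Submodule.mkQ_surjective _)
    fun _ _ _ => ext _ pureInjective_characterModule

variable (R A) in
theorem pureMono_evalDual : PureMono (evalDual R A) :=
  .of_exists_extension (LinearMap.exact_map_mkQ_range _) (Submodule.mkQ_surjective _)
    fun _ _ _ => exists_comp_evalDual_eq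

theorem pureEpi_iff {g : B →ₗ[R] C} :
    PureEpi g ↔ Function.Surjective g ∧ PureMono (LinearMap.ker g).subtype :=
  ⟨fun h => ⟨h.surjective, pureMono_of_exists_extension fun _ _ _ hE φ => hE _ _ _ _ _ h φ⟩,
    fun ⟨hg, h⟩ => h.pureShortExact (LinearMap.exact_subtype_ker_map g) hg⟩

theorem PureInjective.of_retract {E E' : Type v} [AddCommGroup E] [Module R E] [AddCommGroup E']
    [Module R E'] (h : PureInjective R E) (i : E' →ₗ[R] E) (p : E →ₗ[R] E')
    (hpi : p ∘ₗ i = LinearMap.id) : PureInjective R E' := by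
  intro A B C _ _ _ _ _ _ f g hfg φ
  obtain ⟨k, hk⟩ := h A B C f g hfg (i ∘ₗ φ)
  exact ⟨p ∘ₗ k, by rw [LinearMap.comp_assoc, hk, ← LinearMap.comp_assoc, hpi,
    LinearMap.id_comp]⟩

theorem pureInjective_addMonoidHom_characterModule (H : Type v) [AddCommGroup H] :
    PureInjective R (H →+ CharacterModule N) := by
  let i : (H →+ CharacterModule N) →ₗ[R] CharacterModule (TensorProduct ℤ N H) :=
    { toFun L := TensorProduct.liftAddHom (AddMonoidHom.flip L) fun k n h =>
        (congr($(map_zsmul L k h) n).trans (map_zsmul (L h) k n).symm).symm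
      map_add' L L' := intTensor_addHom_ext fun _ _ => rfl
      map_smul' r L := intTensor_addHom_ext fun _ _ => rfl }
  let p : CharacterModule (TensorProduct ℤ N H) →ₗ[R] (H →+ CharacterModule N) :=
    { toFun c := AddMonoidHom.flip (AddMonoidHom.mk' (fun n => AddMonoidHom.comp c
        (TensorProduct.mk ℤ N H n).toAddMonoidHom) fun n n' => AddMonoidHom.ext fun h =>
          (congrArg c (TensorProduct.add_tmul n n' h)).trans (map_add c _ _))
      map_add' _ _ := rfl
      map_smul' _ _ := rfl }
  exact pureInjective_characterModule.of_retract i p rfl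

theorem PureInjective.addMonoidHom {E : Type v} [AddCommGroup E] [Module R E]
    (hE : PureInjective R E) (H : Type v) [AddCommGroup H] : PureInjective R (H →+ E) := by
  obtain ⟨p, hp⟩ := (pureMono_evalDual R E).exists_extension hE LinearMap.id
  let post {E E' : Type v} [AddCommGroup E] [Module R E] [AddCommGroup E'] [Module R E']
      (f : E →ₗ[R] E') : (H →+ E) →ₗ[R] (H →+ E') :=
    { toFun L := f.toAddMonoidHom.comp L
      map_add' L L' := AddMonoidHom.ext fun h => map_add f (L h) (L' h)
      map_smul' r L := AddMonoidHom.ext fun h => f.map_smul r (L h) }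
  exact (pureInjective_addMonoidHom_characterModule H).of_retract (post (evalDual R E)) (post p)
    (LinearMap.ext fun L => AddMonoidHom.ext fun h => congr($hp (L h)))

theorem PureInjective.intLinearMap {E : Type v} [AddCommGroup E] [Module R E]
    (hE : PureInjective R E) (H : Type v) [AddCommGroup H] : PureInjective R (H →ₗ[ℤ] E) :=
  (hE.addMonoidHom H).of_retract (addMonoidHomLequivInt R).symm.toLinearMap
    (addMonoidHomLequivInt R).toLinearMap rfl

theorem exists_pureMono_pureInjective (A : ModuleCat.{v} R) :
    ∃ (E : ModuleCat.{v} R) (ι : A ⟶ E), PureInjective R E ∧ PureMono ι.hom :=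
  ⟨_, ModuleCat.ofHom (evalDual R A), pureInjective_characterModule, pureMono_evalDual R A⟩

theorem mem_of_forall_pureInjective {S : Submodule R A} {a : A}
    (h : ∀ (E : Type v) [AddCommGroup E] [Module R E], PureInjective R E →
      ∀ φ : A →ₗ[R] E, S ≤ LinearMap.ker φ → φ a = 0) : a ∈ S := by
  rw [← Submodule.Quotient.mk_eq_zero]
  refine evalDual_injective (R := R) ?_
  rw [map_zero]
  refine h _ pureInjective_characterModule (evalDual R (A ⧸ S) ∘ₗ S.mkQ) fun x hx => ?_
  rw [LinearMap.mem_ker, LinearMap.comp_apply, Submodule.mkQ_apply,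
    (Submodule.Quotient.mk_eq_zero S).2 hx, map_zero]

end Duality

section PureExactness

variable {R : Type w} [Ring R]

theorem decomposes_iff {A B : ModuleCat.{v} R} (d : A ⟶ B) :
    Decomposes d ↔
      PureMono (LinearMap.ker d.hom).subtype ∧ PureMono (LinearMap.range d.hom).subtype := by
  constructor
  · rintro ⟨D, p, j, hp, hj, h⟩
    have ker_eq : LinearMap.ker p = LinearMap.ker d.hom := by
      rw [← h, LinearMap.ker_comp_of_ker_eq_bot _ (LinearMap.ker_eq_bot.2 hj.injective)]
    refine ⟨ker_eq ▸ (pureEpi_iff.1 hp).2, pureMono_of_exists_extension fun E _ _ hE φ => ?_⟩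
    have j_mem (x : D) : j x ∈ LinearMap.range d.hom := by
      obtain ⟨a, rfl⟩ := hp.surjective x
      exact ⟨a, congr($h a).symm⟩
    obtain ⟨ψ, hψ⟩ := hj.exists_extension hE (φ ∘ₗ j.codRestrict _ j_mem)
    refine ⟨ψ, LinearMap.ext ?_⟩
    rintro ⟨_, a, rfl⟩
    have hφ : φ ⟨j (p a), j_mem (p a)⟩ = φ ⟨d.hom a, a, rfl⟩ :=
      congrArg φ (Subtype.ext congr($h a))
    exact (congrArg ψ congr($h a).symm).trans (congr($hψ (p a)).trans hφ)
  · rintro ⟨hker, hrange⟩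
    refine ⟨ModuleCat.of R (LinearMap.range d.hom), d.hom.rangeRestrict,
      (LinearMap.range d.hom).subtype,
      pureEpi_iff.2 ⟨d.hom.surjective_rangeRestrict, ?_⟩, hrange, rfl⟩
    rwa [LinearMap.ker_rangeRestrict]

theorem d_d_apply (X : CochainComplex (ModuleCat.{v} R) ℤ) (i j k : ℤ) (x : X.X i) :
    X.d j k (X.d i j x) = 0 :=
  congr($(X.d_comp_d i j k) x)

/-- The differential `X^i → Z^j`, with values in the cycles `Z^j = Ker (X^j → X^k)`.  The degrees
are meant to be consecutive. -/
def toCycles (X : CochainComplex (ModuleCat.{v} R) ℤ) (i j k : ℤ) :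
    X.X i →ₗ[R] LinearMap.ker (X.d j k).hom :=
  (X.d i j).hom.codRestrict _ (d_d_apply X i j k)

variable {X : CochainComplex (ModuleCat.{v} R) ℤ}

theorem ker_toCycles (i j k : ℤ) :
    LinearMap.ker (toCycles X i j k) = LinearMap.ker (X.d i j).hom :=
  LinearMap.ker_codRestrict _ _ _

theorem pureEpi_toCycles_iff {i j k : ℤ} : PureEpi (toCycles X i j k) ↔
    Function.Surjective (toCycles X i j k) ∧ PureMono (LinearMap.ker (X.d i j).hom).subtype := by
  rw [pureEpi_iff, ker_toCycles]

theorem exists_d_eq {i j k : ℤ} (h : Function.Surjective (toCycles X i j k)) (x : X.X j)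
    (hx : X.d j k x = 0) : ∃ y, X.d i j y = x :=
  (h ⟨x, hx⟩).imp fun _ hy => congrArg Subtype.val hy

theorem range_d_eq_ker {i j k : ℤ} (h : Function.Surjective (toCycles X i j k)) :
    LinearMap.range (X.d i j).hom = LinearMap.ker (X.d j k).hom := by
  refine le_antisymm ?_ (exists_d_eq h)
  rintro _ ⟨x, rfl⟩
  exact d_d_apply X i j k x

theorem pureExactAt_iff {i j k : ℤ} (hij : i + 1 = j) (hjk : j + 1 = k) :
    PureExactAt X j ↔ PureEpi (toCycles X i j k) ∧
      PureMono (LinearMap.ker (X.d j k).hom).subtype ∧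
        PureMono (LinearMap.range (X.d j k).hom).subtype := by
  obtain rfl : i = j - 1 := by lia
  subst hjk
  rw [PureExactAt, decomposes_iff, decomposes_iff, pureEpi_toCycles_iff]
  constructor
  · rintro ⟨⟨hker, -⟩, hj, h⟩
    refine ⟨⟨?_, hker⟩, hj⟩
    rintro ⟨x, hx⟩
    obtain ⟨y, rfl⟩ := (Submodule.Quotient.mk_eq_zero _).1 ((h.exact x).2 ⟨⟨x, hx⟩, rfl⟩)
    exact ⟨y, rfl⟩
  · rintro ⟨⟨hsurj, hker⟩, hj⟩
    rw [range_d_eq_ker hsurj]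
    refine ⟨⟨hker, hj.1⟩, hj, hj.1.pureShortExact ?_ (Submodule.mkQ_surjective _)⟩
    rw [LinearMap.exact_iff, Submodule.ker_mkQ, Submodule.range_subtype]

variable (X) in
/-- The complex `X` is pure exact in all degrees above `n`.  Exactness at one degree involves three
cycle modules, so the condition is stated through pure epics onto the cycles, which can be treated
one at a time. -/
def PureTail (n : ℤ) : Prop :=
  ∀ i j k : ℤ, n ≤ i → i + 1 = j → j + 1 = k → PureEpi (toCycles X i j k)

theorem pureTail_iff {n : ℤ} : PureTail X n ↔ ∀ j : ℤ, n < j → PureExactAt X j := by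
  constructor
  · intro h j hj
    refine (pureExactAt_iff (sub_add_cancel j 1) rfl).2 ⟨h _ _ _ (by lia) (by lia) rfl, ?_, ?_⟩
    · exact (pureEpi_toCycles_iff.1 (h j (j + 1) _ (by lia) rfl rfl)).2
    · have next := pureEpi_toCycles_iff.1 (h (j + 1) _ _ (by lia) rfl rfl)
      rw [range_d_eq_ker (pureEpi_toCycles_iff.1 (h j (j + 1) _ (by lia) rfl rfl)).1]
      exact next.2
  · intro h i j k hi hij hjk
    exact ((pureExactAt_iff hij hjk).1 (h j (by lia))).1

theorem pureExact_iff_pureTail : PureExact X ↔ ∀ n, PureTail X n := by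
  simp only [pureTail_iff]
  exact ⟨fun h _ j _ => h j, fun h j => h (j - 1) j (by lia)⟩

theorem PureExact.pureEpi_toCycles (hX : PureExact X) {i j k : ℤ} (hij : i + 1 = j)
    (hjk : j + 1 = k) : PureEpi (toCycles X i j k) :=
  pureExact_iff_pureTail.1 hX i i j k le_rfl hij hjk

theorem exists_comp_eq_of_surjective {A B C : ModuleCat.{v} R} {f : A ⟶ B}
    (hf : Function.Surjective f) (g : A ⟶ C) (h : ∀ a, f a = 0 → g a = 0) :
    ∃ k : B ⟶ C, f ≫ k = g :=
  ⟨ModuleCat.ofHom ((LinearMap.ker f.hom).liftQ g.hom h ∘ₗ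
    (f.hom.quotKerEquivOfSurjective hf).symm), ModuleCat.hom_ext <| LinearMap.ext fun x =>
      congrArg ((LinearMap.ker f.hom).liftQ g.hom h)
        ((f.hom.quotKerEquivOfSurjective hf).symm_apply_apply (Submodule.Quotient.mk x))⟩

theorem PureExactAt.exists_factor {i j k : ℤ} (hX : PureExactAt X j) {E : ModuleCat.{v} R}
    (hE : PureInjective R E) (hij : i + 1 = j) (hjk : j + 1 = k) (φ : X.X j ⟶ E)
    (h : X.d i j ≫ φ = 0) : ∃ ψ : X.X k ⟶ E, X.d j k ≫ ψ = φ := by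
  obtain ⟨epi, -, range⟩ := (pureExactAt_iff hij hjk).1 hX
  obtain ⟨κ, hκ⟩ := exists_comp_eq_of_surjective
    (f := ModuleCat.ofHom (X.d j k).hom.rangeRestrict)
    (X.d j k).hom.surjective_rangeRestrict φ fun x hx => by
      obtain ⟨y, rfl⟩ := exists_d_eq epi.surjective x (congrArg Subtype.val hx)
      exact congr($h y)
  obtain ⟨ψ, hψ⟩ := range.exists_extension hE κ.hom
  exact ⟨ModuleCat.ofHom ψ, ModuleCat.hom_ext <| LinearMap.ext fun x =>
    congr($hψ ((X.d j k).hom.rangeRestrict x)).trans congr($hκ x)⟩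

theorem pureExact_of_exists_factor
    (h : ∀ (E : ModuleCat.{v} R), PureInjective R E → ∀ i j k : ℤ, i + 1 = j → j + 1 = k →
      ∀ φ : X.X j ⟶ E, X.d i j ≫ φ = 0 → ∃ ψ : X.X k ⟶ E, X.d j k ≫ ψ = φ) : PureExact X := by
  have surj (i j k : ℤ) (hij : i + 1 = j) (hjk : j + 1 = k) :
      Function.Surjective (toCycles X i j k) := by
    rintro ⟨x, hx⟩
    have : x ∈ LinearMap.range (X.d i j).hom := mem_of_forall_pureInjective fun E _ _ hE φ hφ => by
      obtain ⟨ψ, hψ⟩ := h (ModuleCat.of R E) hE i j k hij hjk (ModuleCat.ofHom φ)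
        (ModuleCat.hom_ext (LinearMap.range_le_ker_iff.1 hφ))
      calc φ x = ψ (X.d j k x) := congr($hψ x).symm
        _ = 0 := (congrArg ψ hx).trans (map_zero ψ.hom)
    exact this.imp fun y hy => Subtype.ext hy
  refine pureExact_iff_pureTail.2 fun _ j k l _ hjk hkl => pureEpi_toCycles_iff.2
    ⟨surj j k l hjk hkl, pureMono_of_exists_extension fun E _ _ hE φ => ?_⟩
  obtain ⟨i, rfl⟩ : ∃ i, i + 1 = j := ⟨j - 1, by lia⟩
  obtain ⟨ψ, hψ⟩ := h (ModuleCat.of R E) hE (i - 1) i (i + 1) (by lia) rfl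
    (ModuleCat.ofHom (φ ∘ₗ toCycles X i (i + 1) k)) (by
      ext x
      exact (congrArg φ (Subtype.ext (d_d_apply X (i - 1) i (i + 1) x))).trans (map_zero φ))
  refine ⟨ψ.hom, LinearMap.ext fun z => ?_⟩
  obtain ⟨y, rfl⟩ := surj i (i + 1) k rfl hjk z
  exact congr($hψ y)

end PureExactness

section TensorComplex

open TensorProduct CochainComplex.HomComplex

variable {R : Type w} [Ring R]

/-- The complex `X ⊗_ℤ H`. -/
def tensorComplex (X : CochainComplex (ModuleCat.{v} R) ℤ) (H : Type v) [AddCommGroup H] :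
    CochainComplex (ModuleCat.{v} R) ℤ where
  X i := ModuleCat.of R (X.X i ⊗[ℤ] H)
  d i j := ModuleCat.ofHom (AlgebraTensorModule.map (X.d i j).hom LinearMap.id)
  shape i j hij := ModuleCat.hom_ext <| AlgebraTensorModule.ext fun x h => by
    simp [X.shape i j hij]
  d_comp_d' i j k _ _ := ModuleCat.hom_ext <| AlgebraTensorModule.ext fun x h => by
    simp [d_d_apply]

variable {X I : CochainComplex (ModuleCat.{v} R) ℤ} {H : Type v} [AddCommGroup H]

variable (X) in
/-- The cochain map `X → X ⊗_ℤ H` sending `x` to `x ⊗ h`. -/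
def tensorInclusion (h : H) : X ⟶ tensorComplex X H where
  f i := ModuleCat.ofHom
    { toFun x := x ⊗ₜ[ℤ] h
      map_add' x y := add_tmul x y h
      map_smul' _ _ := rfl }

theorem tensorInclusion_add (h h' : H) :
    tensorInclusion X (h + h') = tensorInclusion X h + tensorInclusion X h' := by
  ext i x
  exact tmul_add x h h'

theorem tensorComplex_hom_ext {i : ℤ} {E : ModuleCat.{v} R} {f g : (tensorComplex X H).X i ⟶ E}
    (hfg : ∀ h, (tensorInclusion X h).f i ≫ f = (tensorInclusion X h).f i ≫ g) : f = g :=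
  ModuleCat.hom_ext <| AlgebraTensorModule.ext (g := f.hom) fun x h => congr($(hfg h) x)

theorem exists_tensorInclusion_comp_eq {i : ℤ} {E : ModuleCat.{v} R} (φ : H →+ (X.X i ⟶ E)) :
    ∃ f : (tensorComplex X H).X i ⟶ E, ∀ h, (tensorInclusion X h).f i ≫ f = φ h := by
  let ev : X.X i →ₗ[R] (H →ₗ[ℤ] E) :=
    { toFun x := (AddMonoidHom.mk' (fun h => φ h x)
        fun h h' => congr($(map_add φ h h') x)).toIntLinearMap
      map_add' x y := LinearMap.ext fun h => map_add (φ h).hom x y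
      map_smul' r x := LinearMap.ext fun h => map_smul (φ h).hom r x }
  exact ⟨ModuleCat.ofHom (AlgebraTensorModule.lift ev), fun _ => rfl⟩

theorem PureExact.tensorComplex (hX : PureExact X) : PureExact (tensorComplex X H) := by
  refine pureExact_of_exists_factor fun E hE i j k hij hjk φ hφ => ?_
  let φ' : X.X j ⟶ ModuleCat.of R (H →ₗ[ℤ] E) := ModuleCat.ofHom (AlgebraTensorModule.curry φ.hom)
  have hφ' : X.d i j ≫ φ' = 0 := ModuleCat.hom_ext <| LinearMap.ext fun x => LinearMap.ext fun h =>
    congr($hφ (x ⊗ₜ[ℤ] h : X.X i ⊗[ℤ] H))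
  obtain ⟨ψ, hψ⟩ := (hX j).exists_factor (hE.intLinearMap H) hij hjk φ' hφ'
  exact ⟨ModuleCat.ofHom (AlgebraTensorModule.lift ψ.hom),
    tensorComplex_hom_ext fun h => ModuleCat.hom_ext <| LinearMap.ext fun x => congr($hψ x h)⟩

theorem cochain_tensorComplex_ext {m : ℤ} {y z : Cochain (tensorComplex X H) I m}
    (hyz : ∀ h, (Cochain.ofHom (tensorInclusion X h)).comp y (zero_add m) =
      (Cochain.ofHom (tensorInclusion X h)).comp z (zero_add m)) : y = z :=
  Cochain.ext _ _ fun p q hpq => tensorComplex_hom_ext fun h => by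
    simpa only [Cochain.zero_cochain_comp_v, Cochain.ofHom_v] using
      Cochain.congr_v (hyz h) p q hpq

theorem exists_cochain_tensorComplex {m : ℤ} (φ : H →+ Cochain X I m) :
    ∃ z : Cochain (tensorComplex X H) I m,
      ∀ h, (Cochain.ofHom (tensorInclusion X h)).comp z (zero_add m) = φ h := by
  choose f hf using fun p q hpq => exists_tensorInclusion_comp_eq
    (AddMonoidHom.mk' (fun h => (φ h).v p q hpq) fun h h' => by rw [map_add, Cochain.add_v])
  refine ⟨Cochain.mk f, fun h => Cochain.ext _ _ fun p q hpq => ?_⟩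
  rw [Cochain.zero_cochain_comp_v, Cochain.ofHom_v]
  exact hf p q hpq h

/-- A choice of primitives of all cocycles `c : X → I` that is linear in `c` comes from a primitive
of the single tautological cocycle on `X ⊗_ℤ Z`, where `Z` is the group of these cocycles. -/
theorem exists_linear_primitive {i j : ℤ} (k : ℤ) (hij : i + 1 = j) (hjk : j + 1 = k)
    (h : ∀ H : Type v, ∀ [AddCommGroup H], coboundaries (tensorComplex X H) I j = ⊤) :
    ∃ s : LinearMap.ker (δ_hom ℤ X I j k) →ₗ[ℤ] Cochain X I i, ∀ c, δ i j (s c) = c := by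
  obtain ⟨z, hz⟩ := exists_cochain_tensorComplex
    (LinearMap.ker (δ_hom ℤ X I j k)).subtype.toAddMonoidHom
  have δz : δ j k z = 0 := cochain_tensorComplex_ext fun c => by
    rw [← δ_ofHom_comp, hz, Cochain.comp_zero]
    exact c.2
  obtain ⟨y, hy⟩ := (mem_coboundaries_iff (Cocycle.mk z k hjk δz) i hij).1 (by
    rw [h]
    trivial)
  refine ⟨(AddMonoidHom.mk' (fun c => (Cochain.ofHom (tensorInclusion X c)).comp y (zero_add i))
    fun c c' => ?_).toIntLinearMap, fun c => ?_⟩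
  · rw [tensorInclusion_add, Cochain.ofHom_add, Cochain.add_comp]
  · change δ i j ((Cochain.ofHom (tensorInclusion X c)).comp y (zero_add i)) = c
    rw [δ_ofHom_comp, hy]
    exact hz c

end TensorComplex

section HomotopyCategory

open CochainComplex.HomComplex Pretriangulated

variable {R : Type w} [Ring R]

variable (R) in
/-- The projection `C(R) ⥤ K(R)` from complexes to the homotopy category. -/
abbrev toK : CochainComplex (ModuleCat.{v} R) ℤ ⥤
    HomotopyCategory (ModuleCat.{v} R) (ComplexShape.up ℤ) :=
  HomotopyCategory.quotient _ _

variable {X Y I : CochainComplex (ModuleCat.{v} R) ℤ}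

theorem coboundaries_eq_top_iff {m : ℤ} :
    coboundaries X I m = ⊤ ↔ ∀ f : (toK R).obj X ⟶ ((toK R).obj I)⟦m⟧, f = 0 := by
  let e := ((toK R).commShiftIso m).app I
  rw [AddSubgroup.eq_top_iff']
  constructor
  · intro h f
    obtain ⟨c, hc⟩ := (CohomologyClass.toHom_bijective X I m).2 (f ≫ e.inv)
    obtain ⟨z, rfl⟩ := c.mk_surjective
    rw [(CohomologyClass.toHom_mk_eq_zero_iff z).2 (h z)] at hc
    exact (cancel_mono e.inv).1 (hc.symm.trans zero_comp.symm)
  · intro h z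
    rw [← CohomologyClass.toHom_mk_eq_zero_iff, ← cancel_mono e.hom, zero_comp]
    exact h _

theorem coboundaries_zero_eq_top_iff :
    coboundaries X I 0 = ⊤ ↔ ∀ f : (toK R).obj X ⟶ (toK R).obj I, f = 0 := by
  let e := (shiftFunctorZero (HomotopyCategory (ModuleCat.{v} R) (ComplexShape.up ℤ)) ℤ).app
    ((toK R).obj I)
  rw [coboundaries_eq_top_iff]
  refine ⟨fun h f => ?_, fun h f => ?_⟩
  · rw [← cancel_mono e.inv, zero_comp]
    exact h _
  · rw [← cancel_mono e.hom, zero_comp]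
    exact h _

theorem PureExact.isZero_homology (hX : PureExact X) {m : ℤ} : IsZero (X.homology m) := by
  rw [← HomologicalComplex.exactAt_iff_isZero_homology,
    HomologicalComplex.exactAt_iff' _ (m - 1) m (m + 1) (by simp) (by simp),
    ShortComplex.moduleCat_exact_iff]
  exact exists_d_eq (hX.pureEpi_toCycles (sub_add_cancel m 1) rfl).surjective

theorem isZero_homology_homComplex_iff {m : ℤ} :
    IsZero ((homComplex X I).homology m) ↔ coboundaries X I m = ⊤ := by
  rw [← HomologicalComplex.exactAt_iff_isZero_homology,
    HomologicalComplex.exactAt_iff' _ (m - 1) m (m + 1) (by simp) (by simp),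
    ShortComplex.moduleCat_exact_iff, AddSubgroup.eq_top_iff']
  refine ⟨fun h z => ?_, fun h z hz => ?_⟩
  · exact (mem_coboundaries_iff z (m - 1) (by lia)).2 (h z.1 (z.δ_eq_zero (m + 1)))
  · exact (mem_coboundaries_iff (Cocycle.mk z _ rfl hz) (m - 1) (by lia)).1 (h _)

theorem pureEpi_of_section {A B : Type v} [AddCommGroup A] [Module R A] [AddCommGroup B]
    [Module R B] {p : A →ₗ[R] B} (s : B →ₗ[R] A) (hs : p ∘ₗ s = LinearMap.id) : PureEpi p := by
  have hps (b : B) : p (s b) = b := congr($hs b)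
  refine pureEpi_iff.2 ⟨fun b => ⟨s b, hps b⟩, pureMono_of_exists_extension fun E _ _ _ φ => ?_⟩
  refine ⟨φ ∘ₗ (LinearMap.id - s ∘ₗ p).codRestrict _ fun a => ?_, LinearMap.ext fun x =>
    congrArg φ (Subtype.ext ?_)⟩
  · simp
  · simp [hps]

theorem pureExact_homComplex
    (h : ∀ (H : Type v) [AddCommGroup H] (m : ℤ), coboundaries (tensorComplex X H) I m = ⊤) :
    PureExact (homComplex X I) :=
  pureExact_iff_pureTail.2 fun _ i j k _ hij hjk => by
    obtain ⟨s, hs⟩ := exists_linear_primitive (X := X) (I := I) k hij hjk fun H _ => h H j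
    exact pureEpi_of_section s (LinearMap.ext fun c => Subtype.ext (hs c))

variable (R) in
/-- The shifts of stalk complexes of pure injective modules, in the homotopy category. -/
def pureInjectiveStalks :
    ObjectProperty (HomotopyCategory (ModuleCat.{v} R) (ComplexShape.up ℤ)) := fun K =>
  ∃ (E : ModuleCat.{v} R) (n : ℤ), PureInjective R E ∧ Nonempty (K ≅ ((toK R).obj (stalk E))⟦n⟧)

instance : (pureInjectiveStalks.{w, v} R).IsStableUnderShift ℤ where
  isStableUnderShiftBy n := ⟨by
    rintro K ⟨E, m, hE, ⟨e⟩⟩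
    exact ⟨E, m + n, hE, ⟨(CategoryTheory.shiftFunctor _ n).mapIso e ≪≫
      ((shiftFunctorAdd _ m n).app _).symm⟩⟩⟩

variable (R) in
/-- The pure exact complexes, as a full subcategory of the homotopy category.  As a left orthogonal
it is triangulated. -/
abbrev pureAcyclic : ObjectProperty (HomotopyCategory (ModuleCat.{v} R) (ComplexShape.up ℤ)) :=
  (pureInjectiveStalks R).leftOrthogonal

theorem coboundaries_stalk_eq_top_iff {E : ModuleCat.{v} R} {i j k n : ℤ} (hn : j + n = 0)
    (hij : i + 1 = j) (hjk : j + 1 = k) : coboundaries X (stalk E) n = ⊤ ↔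
      ∀ φ : X.X j ⟶ E, X.d i j ≫ φ = 0 → ∃ ψ : X.X k ⟶ E, X.d j k ≫ ψ = φ := by
  rw [AddSubgroup.eq_top_iff']
  constructor
  · intro h φ hφ
    exact (Cocycle.toSingleMk_mem_coboundaries_iff φ hn i hij hφ k hjk).1 (h _)
  · intro h z
    obtain ⟨φ, hφ, rfl⟩ := Cocycle.toSingleMk_surjective z j hn i hij
    exact (Cocycle.toSingleMk_mem_coboundaries_iff φ hn i hij hφ k hjk).2 (h φ hφ)

theorem pureAcyclic_iff : pureAcyclic R ((toK R).obj X) ↔ PureExact X := by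
  constructor
  · intro h
    refine pureExact_of_exists_factor fun E hE i j k hij hjk =>
      (coboundaries_stalk_eq_top_iff (add_neg_cancel j) hij hjk).1 ?_
    exact coboundaries_eq_top_iff.2 fun f => h f ⟨E, -j, hE, ⟨Iso.refl _⟩⟩
  · rintro hX K f ⟨E, n, hE, ⟨e⟩⟩
    rw [← cancel_mono e.hom, zero_comp]
    refine coboundaries_eq_top_iff.1 ((coboundaries_stalk_eq_top_iff (neg_add_cancel n)
      (sub_add_cancel _ 1) rfl).2 ?_) _
    exact (hX _).exists_factor hE (sub_add_cancel _ 1) rfl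

theorem pureQuasiIso_iff_trW {f : X ⟶ Y} :
    PureQuasiIso f ↔ (pureAcyclic R).trW ((toK R).map f) :=
  pureAcyclic_iff.symm.trans ((pureAcyclic R).trW_iff_of_distinguished _
    (HomotopyCategory.mappingCone_triangleh_distinguished f)).symm

theorem rightOrthogonal_iff :
    (pureAcyclic R).rightOrthogonal ((toK R).obj I) ↔
      ∀ X : CochainComplex (ModuleCat.{v} R) ℤ, PureExact X → coboundaries X I 0 = ⊤ := by
  simp only [coboundaries_zero_eq_top_iff]
  refine ⟨fun h X hX f => h f (pureAcyclic_iff.2 hX), fun h K f hK => ?_⟩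
  obtain ⟨X, rfl⟩ := HomotopyCategory.quotient_obj_surjective K
  exact h X (pureAcyclic_iff.1 hK) f

theorem pureExact_homComplex_iff :
    (∀ X : CochainComplex (ModuleCat.{v} R) ℤ, PureExact X → PureExact (homComplex X I)) ↔
      (pureAcyclic R).rightOrthogonal ((toK R).obj I) := by
  constructor
  · exact fun h => rightOrthogonal_iff.2 fun X hX =>
      isZero_homology_homComplex_iff.1 (h X hX).isZero_homology
  · refine fun h X hX => pureExact_homComplex fun H _ m => coboundaries_eq_top_iff.2 fun f =>
      (pureAcyclic R).rightOrthogonal.le_shift m _ h f (pureAcyclic_iff.2 hX.tensorComplex)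

end HomotopyCategory

section BoundedBelow

open CochainComplex.HomComplex

variable {R : Type w} [Ring R]

theorem exists_int_sequence {T : ℤ → Type*} (r : ∀ n, T n → T (n + 1) → Prop) (a : ℤ)
    (x₀ : ∀ n, n ≤ a → T n) (h₀ : ∀ n (hn : n < a), r n (x₀ n hn.le) (x₀ (n + 1) hn))
    (step : ∀ n, a ≤ n → ∀ x : T n, ∃ y, r n x y) :
    ∃ s : ∀ n, T n, (∀ n (hn : n ≤ a), s n = x₀ n hn) ∧ ∀ n, r n (s n) (s (n + 1)) := by
  choose next r_next using step
  let s : ∀ n, T n := fun n =>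
    Int.inductionOn' (motive := T) n a (x₀ a le_rfl) (fun k hk x => next k hk x)
      (fun k hk _ => x₀ (k - 1) (by lia))
  have s_eq (n : ℤ) (hn : n ≤ a) : s n = x₀ n hn := by
    rcases hn.eq_or_lt with rfl | hlt
    · exact Int.inductionOn'_self
    · obtain ⟨m, rfl⟩ : ∃ m, n = m - 1 := ⟨n + 1, by lia⟩
      exact Int.inductionOn'_sub_one (by lia)
  refine ⟨s, s_eq, fun n => ?_⟩
  by_cases hn : n < a
  · rw [s_eq n hn.le, s_eq (n + 1) hn]
    exact h₀ n hn
  · have s_succ : s (n + 1) = next n (not_lt.1 hn) (s n) := Int.inductionOn'_add_one (not_lt.1 hn)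
    rw [s_succ]
    exact r_next _ _ _

theorem PureExact.exists_homotopy_zero {X I : CochainComplex (ModuleCat.{v} R) ℤ}
    (hX : PureExact X) {a : ℤ} (ha : ∀ i ≤ a, IsZero (I.X i))
    (hI : ∀ i, PureInjective R (I.X i)) (f : X ⟶ I) : Nonempty (Homotopy f 0) := by
  let T (n : ℤ) := { t : X.X (n + 1) ⟶ I.X n //
    X.d n (n + 1) ≫ t ≫ I.d n (n + 1) = X.d n (n + 1) ≫ f.f (n + 1) }
  obtain ⟨t, -, ht⟩ := exists_int_sequence (T := T)
    (fun n t t' => X.d (n + 1) (n + 1 + 1) ≫ t'.1 = f.f (n + 1) - t.1 ≫ I.d n (n + 1)) a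
    (fun n hn => ⟨0, by rw [← f.comm, (ha n hn).eq_of_tgt (f.f n) 0]; simp⟩)
    (fun n hn => (ha _ hn).eq_of_tgt _ _)
    (fun n _ t => by
      obtain ⟨t', ht'⟩ := (hX (n + 1)).exists_factor (hI (n + 1)) rfl rfl
        (f.f (n + 1) - t.1 ≫ I.d n (n + 1)) (by rw [Preadditive.comp_sub, t.2, sub_self])
      exact ⟨⟨t', by rw [reassoc_of% ht']; simp⟩, ht'⟩)
  refine ⟨(Cochain.equivHomotopy f 0).symm
    ⟨Cochain.mk fun p q hpq => (X.XIsoOfEq (by lia)).hom ≫ (t q).1, ?_⟩⟩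
  ext q
  obtain ⟨p, rfl⟩ : ∃ p, p + 1 = q := ⟨q - 1, by lia⟩
  rw [Cochain.ofHom_zero, add_zero, Cochain.ofHom_v, δ_v (-1) 0 (by lia) _ _ _ _ p _ (by lia) rfl]
  simp [ht]

theorem rightOrthogonal_of_boundedBelow {I : CochainComplex (ModuleCat.{v} R) ℤ} {a : ℤ}
    (ha : ∀ i ≤ a, IsZero (I.X i)) (hI : ∀ i, PureInjective R (I.X i)) :
    (pureAcyclic R).rightOrthogonal ((toK R).obj I) := by
  intro K f hK
  obtain ⟨X, rfl⟩ := HomotopyCategory.quotient_obj_surjective K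
  obtain ⟨f, rfl⟩ := (toK R).map_surjective f
  exact HomotopyCategory.quotient_map_eq_zero_iff _ |>.2
    ((pureAcyclic_iff.1 hK).exists_homotopy_zero ha hI f)

end BoundedBelow

section PureQuasiIso

variable {R : Type w} [Ring R]

theorem pureQuasiIso_of_exists_factor {X Y : CochainComplex (ModuleCat.{v} R) ℤ} {f : X ⟶ Y}
    (h : ∀ (E : ModuleCat.{v} R), PureInjective R E → ∀ (h i j k : ℤ), h + 1 = i → i + 1 = j →
      j + 1 = k → ∀ (α : X.X j ⟶ E) (κ : Y.X i ⟶ E), Y.d h i ≫ κ = 0 →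
        f.f i ≫ κ = X.d i j ≫ α →
        ∃ (β : X.X k ⟶ E) (γ : Y.X j ⟶ E), α = f.f j ≫ γ - X.d j k ≫ β ∧ κ = Y.d i j ≫ γ) :
    PureQuasiIso f := by
  open CochainComplex in
  refine pureExact_of_exists_factor fun E hE a i j hai hij φ hφ => ?_
  have inl_comp := congrArg (fun ψ => (mappingCone.inl f).v i a (by lia) ≫ ψ) hφ
  have inr_comp := congrArg (fun ψ => (mappingCone.inr f).f a ≫ ψ) hφ
  simp only [mappingCone.inl_v_d_assoc f i a j (by lia) (by lia), Preadditive.sub_comp,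
    Category.assoc, comp_zero, sub_eq_zero] at inl_comp
  simp only [mappingCone.inr_f_d_assoc, comp_zero] at inr_comp
  obtain ⟨β, γ, hβ, hγ⟩ := h E hE a i j (j + 1) hai hij rfl
    ((mappingCone.inl f).v j i (by lia) ≫ φ) ((mappingCone.inr f).f i ≫ φ) inr_comp inl_comp
  refine ⟨(mappingCone.fst f).1.v j (j + 1) rfl ≫ β +
    (mappingCone.snd f).v j j (add_zero j) ≫ γ, ?_⟩
  rw [mappingCone.ext_from_iff f j i hij]
  constructor
  · rw [hβ]
    simp [mappingCone.inl_v_d_assoc f j i (j + 1) (by lia) (by lia), sub_eq_add_neg, add_comm]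
  · rw [hγ]
    simp

end PureQuasiIso

section Resolution

variable {R : Type w} [Ring R]

/-- The part in one degree of a pure injective resolution: a pure injective module with a submodule
of boundaries and a map from the module `M` in the same degree of the complex to be resolved. -/
structure ResolutionStage (M : ModuleCat.{v} R) where
  obj : ModuleCat.{v} R
  boundaries : Submodule R obj
  map : M ⟶ obj
  pureInjective : PureInjective R obj

namespace ResolutionStage

/-- The stage in a degree where the resolution vanishes. -/
def zero (M : ModuleCat.{v} R) : ResolutionStage M where
  obj := ModuleCat.of R PUnit
  boundaries := ⊥
  map := 0
  pureInjective := fun _ _ _ _ _ _ _ _ _ _ _ _ _ => ⟨0, Subsingleton.elim _ _⟩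

/-- The differential `d` connects the stages `S` and `S'` of a resolution of a complex with
differential `f`.  The last condition makes the resolution a pure quasi-isomorphism, see
`pureQuasiIso_of_exists_factor`. -/
structure Step {M M' : ModuleCat.{v} R} (f : M ⟶ M') (S : ResolutionStage M)
    (S' : ResolutionStage M') (d : S.obj ⟶ S'.obj) : Prop where
  range_eq : LinearMap.range d.hom = S'.boundaries
  boundaries_le : S.boundaries ≤ LinearMap.ker d.hom
  comm : S.map ≫ d = f ≫ S'.map
  exists_factor : ∀ (E : ModuleCat.{v} R), PureInjective R E → ∀ (κ : S.obj ⟶ E) (α : M' ⟶ E),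
    S.boundaries ≤ LinearMap.ker κ.hom → S.map ≫ κ = f ≫ α →
      ∃ γ : S'.obj ⟶ E, κ = d ≫ γ ∧ α = S'.map ≫ γ

theorem step_zero {M M' : ModuleCat.{v} R} (f : M ⟶ M') (hM' : IsZero M') :
    (zero M).Step f (zero M') 0 where
  range_eq := LinearMap.range_zero
  boundaries_le := bot_le
  comm := hM'.eq_of_src 0 (zero M').map ▸ rfl
  exists_factor _ _ _ _ _ _ :=
    ⟨0, (ModuleCat.isZero_of_subsingleton (ModuleCat.of R PUnit)).eq_of_src _ _,
      hM'.eq_of_src _ _⟩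

/-- The next stage is a pure injective module containing the pushout of `M'` and the
cokernel of the boundaries. -/
theorem exists_step {M M' : ModuleCat.{v} R} (f : M ⟶ M')
    (S : ResolutionStage M) : ∃ (S' : ResolutionStage M') (d : S.obj ⟶ S'.obj), S.Step f S' d := by
  let q : S.obj ⟶ ModuleCat.of R (S.obj ⧸ S.boundaries) := ModuleCat.ofHom S.boundaries.mkQ
  obtain ⟨J, ι, hJ, hι⟩ := exists_pureMono_pureInjective (pushout (S.map ≫ q) f)
  let d := q ≫ pushout.inl _ _ ≫ ι
  have q_zero (x : S.obj) (hx : x ∈ S.boundaries) : q x = 0 :=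
    (Submodule.Quotient.mk_eq_zero _).2 hx
  refine ⟨⟨_, LinearMap.range d.hom, pushout.inr _ _ ≫ ι, hJ⟩, d,
    rfl, fun x hx => ?_, ?_, fun E hE κ α hκ h => ?_⟩
  · exact (congrArg (pushout.inl _ _ ≫ ι) (q_zero x hx)).trans (map_zero (pushout.inl _ _ ≫ ι).hom)
  · simpa only [Category.assoc] using pushout.condition_assoc (f := S.map ≫ q) (g := f) ι
  · obtain ⟨κ', rfl⟩ : ∃ κ', q ≫ κ' = κ := ⟨ModuleCat.ofHom (S.boundaries.liftQ κ.hom hκ), rfl⟩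
    let δ := pushout.desc κ' α ((Category.assoc _ _ _).trans h)
    obtain ⟨γ, hγ⟩ := hι.exists_extension hE δ.hom
    have ι_γ : ι ≫ ModuleCat.ofHom γ = δ := ModuleCat.hom_ext hγ
    exact ⟨ModuleCat.ofHom γ, by simp only [d, Category.assoc, ι_γ, δ, pushout.inl_desc],
      by rw [Category.assoc, ι_γ, pushout.inr_desc]⟩

end ResolutionStage

theorem exists_resolution_of_boundedBelow {B : CochainComplex (ModuleCat.{v} R) ℤ} {a : ℤ}
    (hB : ∀ i < a, IsZero (B.X i)) :
    ∃ (I : CochainComplex (ModuleCat.{v} R) ℤ) (f : B ⟶ I), IsPureInjectiveResolution f := by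
  obtain ⟨s, hs₀, hs⟩ := exists_int_sequence (T := fun n => ResolutionStage (B.X n))
    (fun n S S' => ∃ d, S.Step (B.d n (n + 1)) S' d) (a - 1)
    (fun _ _ => .zero _)
    (fun n hn => ⟨0, ResolutionStage.step_zero _ (hB _ (by lia))⟩)
    (fun n _ S => S.exists_step _)
  choose d hd using hs
  let I : CochainComplex (ModuleCat.{v} R) ℤ := CochainComplex.of (fun n => (s n).obj) d
    fun n => ModuleCat.hom_ext <| LinearMap.ext fun x =>
      (hd (n + 1)).boundaries_le ((hd n).range_eq ▸ LinearMap.mem_range_self _ x)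
  have I_d (n : ℤ) : I.d n (n + 1) = d n := CochainComplex.of_d (fun n => (s n).obj) d n
  let f : B ⟶ I :=
    { f n := (s n).map
      comm' := by
        rintro i _ rfl
        exact I_d i ▸ (hd i).comm }
  have I_zero (i : ℤ) (hi : i ≤ a - 1) : IsZero (I.X i) := by
    change IsZero (s i).obj
    exact hs₀ i hi ▸ ModuleCat.isZero_of_subsingleton (ModuleCat.of R PUnit)
  refine ⟨I, f, ?_, fun i => (s i).pureInjective, pureExact_homComplex_iff.2
    (rightOrthogonal_of_boundedBelow I_zero fun i => (s i).pureInjective)⟩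
  refine pureQuasiIso_of_exists_factor ?_
  rintro E hE h _ _ k rfl rfl - α κ hκ hα
  rw [I_d] at hκ
  have boundaries_le : (s (h + 1)).boundaries ≤ LinearMap.ker κ.hom := by
    rw [← (hd h).range_eq]
    rintro _ ⟨x, rfl⟩
    exact congr($hκ x)
  obtain ⟨γ, hκγ, hαγ⟩ := (hd (h + 1)).exists_factor E hE κ α boundaries_le hα
  exact ⟨0, γ, by rw [hαγ, comp_zero, sub_zero], I_d (h + 1) ▸ hκγ⟩

end Resolution

section PureDerivedCategory

open Pretriangulated

theorem trW_of_comp {C : Type*} [Category* C] [HasZeroObject C] [HasShift C ℤ] [Preadditive C]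
    [∀ n : ℤ, (CategoryTheory.shiftFunctor C n).Additive] [Pretriangulated C] [IsTriangulated C]
    (P : ObjectProperty C) [P.IsTriangulated] [P.IsClosedUnderIsomorphisms] {X Y Z : C}
    {f : X ⟶ Y} {g : Y ⟶ Z} (hf : P.trW f) (hfg : P.trW (f ≫ g)) : P.trW g := by
  obtain ⟨K, _, _, hK, hPK⟩ := hf
  obtain ⟨L, _, _, hL, hPL⟩ := hfg
  obtain ⟨M, _, _, hM⟩ := distinguished_cocone_triangle g
  exact ⟨M, _, _, hM,
    P.ext_of_isTriangulatedClosed₃ _ (Triangulated.someOctahedron rfl hK hM hL).mem hPK hPL⟩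

variable {R : Type w} [Ring R] {X Y I J : CochainComplex (ModuleCat.{v} R) ℤ}

theorem isPureInjectiveResolution_iff {f : Y ⟶ I} : IsPureInjectiveResolution f ↔
    (pureAcyclic R).trW ((toK R).map f) ∧ (∀ i, PureInjective R (I.X i)) ∧
      (pureAcyclic R).rightOrthogonal ((toK R).obj I) := by
  rw [← pureQuasiIso_iff_trW, ← pureExact_homComplex_iff]
  exact ⟨fun h => ⟨h.1, h.2, h.3⟩, fun ⟨h₁, h₂, h₃⟩ => ⟨h₁, h₂, h₃⟩⟩

theorem bijective_map_comp {K : HomotopyCategory (ModuleCat.{v} R) (ComplexShape.up ℤ)}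
    {f : X ⟶ Y} (hf : PureQuasiIso f) (hK : (pureAcyclic R).rightOrthogonal K) :
    Function.Bijective fun g : (toK R).obj Y ⟶ K => (toK R).map f ≫ g := by
  rw [← ObjectProperty.isLocal_trW] at hK
  exact hK _ (pureQuasiIso_iff_trW.1 hf)

theorem exists_resolution (hY : InDbpur Y) :
    ∃ (I : CochainComplex (ModuleCat.{v} R) ℤ) (f : Y ⟶ I), IsPureInjectiveResolution f := by
  obtain ⟨B, ⟨a, _, hB⟩, Z, s, t, hs, ht⟩ := hY
  obtain ⟨I, f, hf⟩ := exists_resolution_of_boundedBelow fun i (hi : i < a) => hB i (.inl hi)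
  obtain ⟨hf, hI, orth⟩ := isPureInjectiveResolution_iff.1 hf
  obtain ⟨g, hg⟩ := (bijective_map_comp hs orth).2 ((toK R).map (t ≫ f))
  obtain ⟨g, rfl⟩ := (toK R).map_surjective g
  refine ⟨I, g, isPureInjectiveResolution_iff.2 ⟨?_, hI, orth⟩⟩
  refine trW_of_comp _ (pureQuasiIso_iff_trW.1 hs) ?_
  rw [show (toK R).map s ≫ (toK R).map g = _ from hg, Functor.map_comp]
  exact (pureAcyclic R).trW.comp_mem _ _ (pureQuasiIso_iff_trW.1 ht) hf

theorem IsPureInjectiveResolution.exists_chosenResolution {f : Y ⟶ I}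
    (hf : IsPureInjectiveResolution f) :
    ∃ g : Y ⟶ chosenResolution Y, IsPureInjectiveResolution g := by
  rw [chosenResolution, dif_pos ⟨I, f, hf⟩]
  exact Exists.choose_spec (p := fun I => ∃ g : Y ⟶ I, IsPureInjectiveResolution g) _

theorem IsPureInjectiveResolution.nonempty_iso {f : Y ⟶ I} {g : Y ⟶ J}
    (hf : IsPureInjectiveResolution f) (hg : IsPureInjectiveResolution g) :
    Nonempty ((toK R).obj I ≅ (toK R).obj J) := by
  obtain ⟨-, -, orth_I⟩ := isPureInjectiveResolution_iff.1 hf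
  obtain ⟨-, -, orth_J⟩ := isPureInjectiveResolution_iff.1 hg
  obtain ⟨p, hp⟩ := (bijective_map_comp hf.pureQuasiIso orth_J).2 ((toK R).map g)
  obtain ⟨q, hq⟩ := (bijective_map_comp hg.pureQuasiIso orth_I).2 ((toK R).map f)
  dsimp only at hp hq
  refine ⟨⟨p, q, (bijective_map_comp hf.pureQuasiIso orth_I).1 ?_,
    (bijective_map_comp hg.pureQuasiIso orth_J).1 ?_⟩⟩
  · dsimp only
    rw [reassoc_of% hp, hq, Category.comp_id]
  · dsimp only
    rw [reassoc_of% hq, hp, Category.comp_id]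

end PureDerivedCategory

section HomotopyInvariance

open Pretriangulated

variable {R : Type w} [Ring R] {X Y : CochainComplex (ModuleCat.{v} R) ℤ}

theorem f_d_apply (f : X ⟶ Y) (i j : ℤ) (x : X.X i) : f.f j (X.d i j x) = Y.d i j (f.f i x) :=
  congr($(f.comm i j) x).symm

/-- The map induced by `f` on the cycles in degree `j`, the next degree being `k`. -/
def mapCycles (f : X ⟶ Y) (j k : ℤ) :
    LinearMap.ker (X.d j k).hom →ₗ[R] LinearMap.ker (Y.d j k).hom :=
  (f.f j).hom.restrict fun x hx =>
    (f_d_apply f j k x).symm.trans ((congrArg (f.f k) hx).trans (map_zero (f.f k).hom))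

theorem homotopy_apply_of_d_eq_zero {f g : X ⟶ Y} (h : Homotopy f g) {i j k : ℤ}
    (hij : i + 1 = j) (hjk : j + 1 = k) {x : X.X j} (hx : X.d j k x = 0) :
    f.f j x = Y.d i j (h.hom j i x) + g.f j x := by
  have comm := h.comm j
  rw [dNext_eq h.hom (show (ComplexShape.up ℤ).Rel j k from hjk),
    prevD_eq h.hom (show (ComplexShape.up ℤ).Rel i j from hij)] at comm
  calc f.f j x = h.hom k j (X.d j k x) + Y.d i j (h.hom j i x) + g.f j x := congr($comm x)
    _ = _ := by rw [hx, map_zero, zero_add]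

theorem d_sub_homotopy {f : X ⟶ Y} {g : Y ⟶ X} (h : Homotopy (f ≫ g) (𝟙 X)) {i j k : ℤ}
    (hij : i + 1 = j) (hjk : j + 1 = k) {x : X.X j} (hx : X.d j k x = 0) {y : Y.X i}
    (hy : Y.d i j y = f.f j x) : X.d i j (g.f i y - h.hom j i x) = x :=
  calc X.d i j (g.f i y - h.hom j i x)
      = g.f j (Y.d i j y) - X.d i j (h.hom j i x) := by rw [map_sub, f_d_apply]
    _ = g.f j (f.f j x) - X.d i j (h.hom j i x) := by rw [hy]
    _ = x := sub_eq_of_eq_add' (homotopy_apply_of_d_eq_zero h hij hjk hx)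

variable (X) in
/-- The maps of `X` onto the cycles have sections in all degrees above `n`. -/
def SplitAbove (n : ℤ) : Prop :=
  ∀ i j k : ℤ, n ≤ i → i + 1 = j → j + 1 = k → ∃ s, toCycles X i j k ∘ₗ s = LinearMap.id

theorem SplitAbove.pureTail {n : ℤ} (h : SplitAbove X n) : PureTail X n :=
  fun i j k hi hij hjk => (h i j k hi hij hjk).elim pureEpi_of_section

theorem splitAbove_of_isZero {n : ℤ} (h : ∀ i, n < i → IsZero (X.X i)) : SplitAbove X n :=
  fun i j _ hi hij _ => ⟨0, LinearMap.ext fun x => Subtype.ext <|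
    (congr($((h j (by lia)).eq_of_src (𝟙 (X.X j)) 0) x.1).trans (map_zero (X.d i j).hom).symm).symm⟩

theorem SplitAbove.of_homotopy {n : ℤ} (hY : SplitAbove Y n) {f : X ⟶ Y} {g : Y ⟶ X}
    (h : Homotopy (f ≫ g) (𝟙 X)) : SplitAbove X n := by
  intro i j k hi hij hjk
  obtain ⟨s, hs⟩ := hY i j k hi hij hjk
  refine ⟨(g.f i).hom ∘ₗ s ∘ₗ mapCycles f j k -
    (h.hom j i).hom ∘ₗ (LinearMap.ker (X.d j k).hom).subtype,
    LinearMap.ext fun x => Subtype.ext ?_⟩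
  exact d_sub_homotopy (y := s (mapCycles f j k x)) h hij hjk x.2
    (congrArg Subtype.val congr($hs (mapCycles f j k x)))

theorem PureTail.of_homotopy {n : ℤ} (hY : PureTail Y n) {f : X ⟶ Y} {g : Y ⟶ X}
    (h : Homotopy (f ≫ g) (𝟙 X)) : PureTail X n := by
  intro i j k hi hij hjk
  obtain ⟨surj, pure⟩ := pureEpi_toCycles_iff.1 (hY i j k hi hij hjk)
  refine pureEpi_toCycles_iff.2 ⟨fun x => ?_, ?_⟩
  · obtain ⟨y, hy⟩ := surj (mapCycles f j k x)
    exact ⟨_, Subtype.ext (d_sub_homotopy h hij hjk x.2 (congrArg Subtype.val hy))⟩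
  · obtain ⟨l, hli⟩ : ∃ l, l + 1 = i := ⟨i - 1, by lia⟩
    refine pureMono_of_exists_extension fun E _ _ hE φ => ?_
    obtain ⟨ψ, hψ⟩ := pure.exists_extension hE (φ ∘ₗ mapCycles g i j)
    refine ⟨ψ ∘ₗ (f.f i).hom - φ ∘ₗ toCycles X l i j ∘ₗ (h.hom i l).hom, LinearMap.ext fun x => ?_⟩
    have key : mapCycles g i j (mapCycles f i j x) = toCycles X l i j (h.hom i l x.1) + x :=
      Subtype.ext (homotopy_apply_of_d_eq_zero h hli hij x.2)
    calc ψ (f.f i x.1) - φ (toCycles X l i j (h.hom i l x.1))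
        = φ (mapCycles g i j (mapCycles f i j x)) - φ (toCycles X l i j (h.hom i l x.1)) :=
          congrArg (· - _) congr($hψ (mapCycles f i j x))
      _ = φ x := by rw [key, map_add, add_sub_cancel_left]

end HomotopyInvariance

section Triangles

open Pretriangulated

variable {R : Type w} [Ring R]

variable {X Y Z : CochainComplex (ModuleCat.{v} R) ℤ}

section DegreewiseSplit

variable {f : X ⟶ Y} {g : Y ⟶ Z} {r : ∀ i, Y.X i ⟶ X.X i} {s : ∀ i, Z.X i ⟶ Y.X i}
  (r_f : ∀ i x, r i (f.f i x) = x) (g_s : ∀ i z, g.f i (s i z) = z)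
  (f_r_add : ∀ i y, f.f i (r i y) + s i (g.f i y) = y)

include r_f f_r_add

theorem exists_mapCycles_eq {j k : ℤ} (y : LinearMap.ker (Y.d j k).hom)
    (hy : mapCycles g j k y = 0) : ∃ x, mapCycles f j k x = y ∧ x.1 = r j y.1 := by
  have f_r : f.f j (r j y.1) = y.1 := by
    have g_y : g.f j y.1 = 0 := congrArg Subtype.val hy
    have := f_r_add j y.1
    rwa [g_y, map_zero, add_zero] at this
  refine ⟨⟨r j y.1, ?_⟩, Subtype.ext f_r, rfl⟩
  calc X.d j k (r j y.1) = r k (f.f k (X.d j k (r j y.1))) := (r_f k _).symm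
    _ = r k (Y.d j k y.1) := by rw [f_d_apply, f_r]
    _ = 0 := (congrArg (r k) y.2).trans (map_zero (r k).hom)

include g_s

theorem mapCycles_surjective {i j k : ℤ} (h : Function.Surjective (toCycles X i j k)) :
    Function.Surjective (mapCycles g i j) := by
  intro z
  obtain ⟨u, hu, -⟩ := exists_mapCycles_eq r_f f_r_add (toCycles Y i j k (s i z.1)) <|
    Subtype.ext ((f_d_apply g i j _).trans ((congrArg (Z.d i j) (g_s i z.1)).trans z.2))
  obtain ⟨x, rfl⟩ := h u
  have f_x : f.f j (X.d i j x) = Y.d i j (s i z.1) := congrArg Subtype.val hu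
  have g_f : g.f i (f.f i x) = 0 := by
    have := congrArg (g.f i) (f_r_add i (f.f i x))
    rwa [r_f, map_add, g_s, add_eq_left] at this
  refine ⟨⟨s i z.1 - f.f i x, ?_⟩, Subtype.ext ?_⟩
  · calc Y.d i j (s i z.1 - f.f i x) = Y.d i j (s i z.1) - f.f j (X.d i j x) := by
          rw [map_sub, f_d_apply]
      _ = 0 := by rw [f_x, sub_self]
  · calc g.f i (s i z.1 - f.f i x) = z.1 := by rw [map_sub, g_s, g_f, sub_zero]

theorem PureTail.of_degreewiseSplit {n : ℤ} (hX : PureTail X n) (hZ : PureTail Z n) :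
    PureTail Y n := by
  intro i j k hi hij hjk
  obtain ⟨surj_X, pure_X⟩ := pureEpi_toCycles_iff.1 (hX i j k hi hij hjk)
  obtain ⟨surj_Z, pure_Z⟩ := pureEpi_toCycles_iff.1 (hZ i j k hi hij hjk)
  refine pureEpi_toCycles_iff.2 ⟨fun y => ?_, pureMono_of_exists_extension fun E _ _ hE φ => ?_⟩
  · obtain ⟨z, hz⟩ := surj_Z (mapCycles g j k y)
    obtain ⟨u, hu, -⟩ := exists_mapCycles_eq r_f f_r_add (y - toCycles Y i j k (s i z)) <| by
      rw [map_sub, ← hz, sub_eq_zero]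
      exact Subtype.ext ((f_d_apply g i j _).trans (congrArg (Z.d i j) (g_s i z))).symm
    obtain ⟨x, rfl⟩ := surj_X u
    refine ⟨f.f i x + s i z, ?_⟩
    rw [map_add, ← eq_sub_iff_add_eq, ← hu]
    exact Subtype.ext (f_d_apply f i j x).symm
  · obtain ⟨ψ, hψ⟩ := pure_X.exists_extension hE (φ ∘ₗ mapCycles f i j)
    let ρ : Y.X i →ₗ[R] E := ψ ∘ₗ (r i).hom
    obtain ⟨κ, hκ⟩ := exists_comp_eq_of_surjective (C := ModuleCat.of R E)
      (f := ModuleCat.ofHom (mapCycles g i j)) (mapCycles_surjective r_f g_s f_r_add surj_X)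
      (ModuleCat.ofHom (φ - ρ ∘ₗ (LinearMap.ker (Y.d i j).hom).subtype)) fun y hy => by
        obtain ⟨x, rfl, hx⟩ := exists_mapCycles_eq r_f f_r_add y hy
        exact sub_eq_zero.2 (congr($hψ x).symm.trans (congrArg ψ hx))
    obtain ⟨χ, hχ⟩ := pure_Z.exists_extension hE κ.hom
    refine ⟨ρ + χ ∘ₗ (g.f i).hom, LinearMap.ext fun y => ?_⟩
    calc ρ y.1 + χ (g.f i y.1)
        = ρ y.1 + κ (mapCycles g i j y) := congrArg (_ + ·) congr($hχ (mapCycles g i j y))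
      _ = ρ y.1 + (φ y - ρ y.1) := congrArg (_ + ·) congr($hκ y)
      _ = φ y := add_sub_cancel _ _

end DegreewiseSplit

theorem homotopy_of_iso (e : (toK R).obj X ≅ (toK R).obj Y) :
    ∃ (f : X ⟶ Y) (g : Y ⟶ X), Nonempty (Homotopy (f ≫ g) (𝟙 X)) := by
  obtain ⟨f, hf⟩ := (toK R).map_surjective e.hom
  obtain ⟨g, hg⟩ := (toK R).map_surjective e.inv
  exact ⟨f, g, ⟨HomotopyCategory.homotopyOfEq _ _ (by simp [hf, hg])⟩⟩

theorem SplitAbove.of_iso {n : ℤ} (e : (toK R).obj X ≅ (toK R).obj Y) (hY : SplitAbove Y n) :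
    SplitAbove X n := by
  obtain ⟨f, g, ⟨h⟩⟩ := homotopy_of_iso e
  exact hY.of_homotopy h

theorem PureTail.of_iso {n : ℤ} (e : (toK R).obj X ≅ (toK R).obj Y) (hY : PureTail Y n) :
    PureTail X n := by
  obtain ⟨f, g, ⟨h⟩⟩ := homotopy_of_iso e
  exact hY.of_homotopy h

theorem PureTail.of_distinguished {n : ℤ}
    {T : Triangle (HomotopyCategory (ModuleCat.{v} R) (ComplexShape.up ℤ))} (hT : T ∈ distTriang _)
    (h₁ : PureTail T.obj₁.as n) (h₃ : PureTail T.obj₃.as n) : PureTail T.obj₂.as n := by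
  obtain ⟨S, σ, ⟨e⟩⟩ := (HomotopyCategory.distinguished_iff_iso_trianglehOfDegreewiseSplit T).1 hT
  exact .of_iso (Triangle.π₂.mapIso e) <| .of_degreewiseSplit
    (fun i x => congr($((σ i).f_r) x)) (fun i x => congr($((σ i).s_g) x))
    (fun i x => congr($((σ i).id) x))
    (h₁.of_iso (Triangle.π₁.mapIso e.symm)) (h₃.of_iso (Triangle.π₃.mapIso e.symm))

theorem PureQuasiIso.pureTail_iff {f : X ⟶ Y} (hf : PureQuasiIso f) {n : ℤ} :
    PureTail X n ↔ PureTail Y n := by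
  have tri := HomotopyCategory.mappingCone_triangleh_distinguished f
  have tail (K : HomotopyCategory (ModuleCat.{v} R) (ComplexShape.up ℤ)) (hK : pureAcyclic R K) :
      PureTail K.as n := pureExact_iff_pureTail.1 (pureAcyclic_iff.1 hK) n
  have cone := pureAcyclic_iff.2 hf
  exact ⟨fun h => .of_distinguished tri h (tail _ cone),
    fun h => .of_distinguished (inv_rot_of_distTriang _ tri)
      (tail _ ((pureAcyclic R).le_shift (-1) _ cone)) h⟩

end Triangles

section Amplitude

variable {R : Type w} [Ring R] {X : CochainComplex (ModuleCat.{v} R) ℤ}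

theorem ext_le_ext {m n : ℤ} : ext m ≤ ext n ↔ m ≤ n := by
  rw [EReal.coe_le_coe_iff, Int.cast_le]

theorem supp_le_iff {n : ℤ} : supp X ≤ ext n ↔ PureTail X n := by
  simp only [pureTail_iff, supp, sSup_le_iff, Set.forall_mem_image, Set.mem_ofPred_eq, ext_le_ext]
  exact forall_congr' fun j => ⟨fun h hj => not_not.1 fun hX => (h hX).not_gt hj,
    fun h hX => not_lt.1 fun hj => hX (h hj)⟩

theorem ext_lt_infp_iff {m : ℤ} : ext m < infp X ↔ ∀ j ≤ m, PureExactAt X j := by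
  constructor
  · exact fun h j hj => by_contra fun hX =>
      (h.trans_le (sInf_le ⟨j, hX, rfl⟩)).not_ge (ext_le_ext.2 hj)
  · refine fun h => lt_of_lt_of_le (b := ext (m + 1)) (lt_of_not_ge fun hm => ?_) (le_sInf ?_)
    · exact absurd (ext_le_ext.1 hm) (by lia)
    · rintro _ ⟨j, hX, rfl⟩
      exact ext_le_ext.2 (Int.add_one_le_of_lt (lt_of_not_ge fun hj => hX (h j hj)))

theorem pid_le_iff {n : ℤ} : pid X ≤ ext n ↔ HasResolutionUpTo X n := by
  refine ⟨fun h => by_contra fun hn => ?_, fun h => sInf_le ⟨n, h, rfl⟩⟩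
  have lower : ext (n + 1) ≤ pid X := by
    refine le_sInf ?_
    rintro _ ⟨m, ⟨I, f, hf, hI⟩, rfl⟩
    exact ext_le_ext.2 <| Int.add_one_le_of_lt <| not_le.1 fun hm =>
      hn ⟨I, f, hf, fun i hi => hI i (hm.trans_lt hi)⟩
  exact absurd (ext_le_ext.1 (lower.trans h)) (by lia)

theorem ext_sub_infp_lt_iff {n i : ℤ} :
    ext n - infp X < ext i ↔ ∀ j ≤ n - i, PureExactAt X j := by
  have ext_sub : ext (n - i) = ext n - ext i :=
    (congrArg Real.toEReal (Int.cast_sub n i)).trans (EReal.coe_sub _ _)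
  rw [← ext_lt_infp_iff, ext_sub,
    EReal.sub_lt_iff (.inr (EReal.coe_ne_bot _)) (.inr (EReal.coe_ne_top _)), add_comm,
    ← EReal.sub_lt_iff (.inl (EReal.coe_ne_bot _)) (.inl (EReal.coe_ne_top _))]

theorem pureExactAt_of_isZero {j : ℤ} (h : IsZero (X.X j)) : PureExactAt X j := by
  have : Subsingleton (X.X j) := ModuleCat.subsingleton_of_isZero h
  refine (pureExactAt_iff (sub_add_cancel j 1) rfl).2
    ⟨pureEpi_of_section 0 (Subsingleton.elim _ _),
      pureMono_of_exists_extension fun E _ _ _ φ => ⟨0, Subsingleton.elim _ _⟩,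
      pureMono_of_exists_extension fun E _ _ _ φ => ⟨0, LinearMap.ext ?_⟩⟩
  rintro ⟨_, x, rfl⟩
  obtain rfl := Subsingleton.elim x 0
  exact (congrArg φ (Subtype.ext (map_zero (X.d j (j + 1)).hom))).trans (map_zero φ) |>.symm

end Amplitude

section Splitting

variable {R : Type w} [Ring R]

theorem PureEpi.exists_section {A B : Type v} [AddCommGroup A] [Module R A] [AddCommGroup B]
    [Module R B] {p : A →ₗ[R] B} (hp : PureEpi p) (h : PureInjective R (LinearMap.ker p)) :
    ∃ s, p ∘ₗ s = LinearMap.id :=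
  ((hp.exact.split_tfae hp.injective hp.surjective).out 0 1).2
    (h _ _ _ _ _ hp LinearMap.id)

theorem PureInjective.ker_of_section {A B : Type v} [AddCommGroup A] [Module R A]
    [AddCommGroup B] [Module R B] {p : A →ₗ[R] B} (hA : PureInjective R A) (s : B →ₗ[R] A)
    (hs : p ∘ₗ s = LinearMap.id) : PureInjective R (LinearMap.ker p) := by
  have hp := pureEpi_of_section s hs
  have split : (∃ s, p ∘ₗ s = LinearMap.id) ↔ ∃ r, r ∘ₗ (LinearMap.ker p).subtype = LinearMap.id :=
    (hp.exact.split_tfae hp.injective hp.surjective).out 0 1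
  obtain ⟨r, hr⟩ := split.1 ⟨s, hs⟩
  exact hA.of_retract _ r hr

variable {I : CochainComplex (ModuleCat.{v} R) ℤ}

theorem SplitAbove.pureInjective_ker {n : ℤ} (h : SplitAbove I n) (hI : PureInjective R (I.X n)) :
    PureInjective R (LinearMap.ker (I.d n (n + 1)).hom) := by
  obtain ⟨s, hs⟩ := h n _ _ le_rfl rfl rfl
  exact ker_toCycles (X := I) n _ (n + 1 + 1) ▸ hI.ker_of_section s hs

theorem PureTail.splitAbove {n : ℤ} (h : PureTail I n) (hI : ∀ i, PureInjective R (I.X i))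
    (hn : PureInjective R (LinearMap.ker (I.d n (n + 1)).hom)) : SplitAbove I n := by
  have exists_section {i j k : ℤ} (hi : n ≤ i) (hij : i + 1 = j) (hjk : j + 1 = k)
      (hker : PureInjective R (LinearMap.ker (I.d i j).hom)) :
      ∃ s, toCycles I i j k ∘ₗ s = LinearMap.id :=
    (h i j k hi hij hjk).exists_section (ker_toCycles (X := I) i j k ▸ hker)
  have ker (i : ℤ) (hi : n ≤ i) : PureInjective R (LinearMap.ker (I.d i (i + 1)).hom) := by
    induction i, hi using Int.leInduction with
    | base => exact hn
    | succ i hi ih =>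
      obtain ⟨s, hs⟩ := exists_section hi rfl rfl ih
      exact (hI i).of_retract s _ hs
  rintro i _ k hi rfl hjk
  exact exists_section hi rfl hjk (ker i hi)

end Splitting

section Decomposition

variable {R : Type w} [Ring R] {I : CochainComplex (ModuleCat.{v} R) ℤ}

theorem SplitAbove.exists_contraction {n : ℤ} (hI : SplitAbove I n) :
    ∃ h : ∀ i j, (ComplexShape.up ℤ).Rel j i → (I.X i ⟶ I.X j),
      (∀ i j hij, i ≤ n → h i j hij = 0) ∧
      ∀ i j k hij hjk, n < j → I.d j k ≫ h k j hjk + h j i hij ≫ I.d i j = 𝟙 (I.X j) := by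
  choose s hs using hI
  have d_s {i j k : ℤ} (hi : n ≤ i) (hij : i + 1 = j) (hjk : j + 1 = k)
      (z : LinearMap.ker (I.d j k).hom) : I.d i j (s i j k hi hij hjk z) = z :=
    congrArg Subtype.val congr($(hs i j k hi hij hjk) z)
  let r (i : ℤ) (hi : n ≤ i) : I.X i →ₗ[R] LinearMap.ker (I.d i (i + 1)).hom :=
    (LinearMap.id - s i _ _ hi rfl rfl ∘ₗ toCycles I i (i + 1) (i + 1 + 1)).codRestrict _ fun x =>
      (map_sub (I.d i (i + 1)).hom _ _).trans <| sub_eq_zero.2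
        (d_s hi rfl rfl (toCycles I i (i + 1) (i + 1 + 1) x)).symm
  have r_eq (i : ℤ) (hi : n ≤ i) (z : LinearMap.ker (I.d i (i + 1)).hom) : r i hi z.1 = z := by
    have z_cycle : toCycles I i (i + 1) (i + 1 + 1) z.1 = 0 := Subtype.ext z.2
    refine Subtype.ext (sub_eq_self.2 ?_)
    exact (congrArg (s i _ _ hi rfl rfl) z_cycle).trans (map_zero (s i _ _ hi rfl rfl))
  let c (i j : ℤ) (hij : j + 1 = i) (hj : n ≤ j) : I.X i ⟶ I.X j :=
    ModuleCat.ofHom (s j i _ hj hij rfl ∘ₗ r i (by lia))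
  have c_one (i j k : ℤ) (hij : i + 1 = j) (hjk : j + 1 = k) (hi : n ≤ i) (hj : n ≤ j) :
      I.d j k ≫ c k j hjk hj + c j i hij hi ≫ I.d i j = 𝟙 (I.X j) := by
    subst hjk
    refine ModuleCat.hom_ext <| LinearMap.ext fun x => ?_
    calc s j _ _ hj rfl rfl (r (j + 1) _ (toCycles I j (j + 1) (j + 1 + 1) x).1) +
          I.d i j (s i j (j + 1) hi hij rfl (r j hj x))
        = s j _ _ hj rfl rfl (toCycles I j (j + 1) (j + 1 + 1) x) + r j hj x := by
          rw [r_eq, d_s]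
      _ = x := add_sub_cancel _ _
  have succ_eq {i j : ℤ} (hij : (ComplexShape.up ℤ).Rel i j) : i + 1 = j := hij
  refine ⟨fun i j hij => if hj : n ≤ j then c i j (succ_eq hij) hj else 0,
    fun i j hij hi => dif_neg (by have := succ_eq hij; lia), fun i j k hij hjk hj => ?_⟩
  have hi : n ≤ i := by have := succ_eq hij; lia
  simp only [dif_pos hj.le, dif_pos hi]
  exact c_one i j k hij hjk hi hj.le

theorem SplitAbove.exists_idempotent {n : ℤ} (hI : SplitAbove I n) :
    ∃ p : I ⟶ I, p ≫ p = p ∧ Nonempty (Homotopy p 0) ∧ ∀ j, n < j → p.f j = 𝟙 (I.X j) := by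
  obtain ⟨h, h_zero, h_one⟩ := hI.exists_contraction
  have p_f {i j k : ℤ} (hij : (ComplexShape.up ℤ).Rel i j) (hjk : (ComplexShape.up ℤ).Rel j k) :
      (Homotopy.nullHomotopicMap' h).f j = I.d j k ≫ h k j hjk + h j i hij ≫ I.d i j :=
    Homotopy.nullHomotopicMap'_f _ _ _
  refine ⟨Homotopy.nullHomotopicMap' h, ?_, ⟨Homotopy.nullHomotopy' h⟩, fun j hj =>
    (p_f (sub_add_cancel j 1) rfl).trans (h_one _ _ _ _ _ hj)⟩
  ext j : 1
  have hij : (ComplexShape.up ℤ).Rel (j - 1) j := sub_add_cancel j 1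
  have hjk : (ComplexShape.up ℤ).Rel j (j + 1) := rfl
  rw [HomologicalComplex.comp_f, p_f hij hjk]
  rcases lt_trichotomy j n with hj | rfl | hj
  · rw [h_zero j _ _ hj.le, h_zero (j + 1) j _ hj]
    simp
  · have d_h_d := congr(I.d j (j + 1) ≫ $(h_one j (j + 1) _ hjk rfl (lt_add_one j)))
    rw [Preadditive.comp_add, I.d_comp_d_assoc, zero_comp, zero_add, Category.comp_id] at d_h_d
    rw [h_zero j _ _ le_rfl, zero_comp, add_zero, Category.assoc, reassoc_of% d_h_d]
  · rw [h_one _ _ _ _ _ hj, Category.comp_id]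

theorem SplitAbove.exists_iso_biprod {n : ℤ} (hI : SplitAbove I n) :
    ∃ I₁ I₂ : CochainComplex (ModuleCat.{v} R) ℤ, Nonempty (I ≅ I₁ ⊞ I₂) ∧
      (∀ i, n < i → IsZero (I₁.X i)) ∧ Contractible I₂ := by
  obtain ⟨p, idem, ⟨null⟩, p_f⟩ := hI.exists_idempotent
  obtain ⟨I₂, i, e, i_e, e_i⟩ := IsIdempotentComplete.idempotents_split I p idem
  have : IsSplitMono i := .mk' ⟨e, i_e⟩
  refine ⟨cokernel i, I₂, ⟨biprod.uniqueUpToIso _ _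
    (isBilimitBinaryBiconeOfIsSplitMonoOfCokernel (cokernelIsCokernel i)) ≪≫
      biprod.braiding _ _⟩, fun j hj => ?_, ⟨?_⟩⟩
  · have : Epi (i.f j) := by
      have : IsSplitEpi (i.f j) :=
        .mk' ⟨e.f j, (HomologicalComplex.congr_hom e_i j).trans (p_f j hj)⟩
      infer_instance
    exact IsZero.of_epi_eq_zero ((cokernel.π i).f j) <| (cancel_epi (i.f j)).1 <|
      (HomologicalComplex.congr_hom (cokernel.condition i) j).trans comp_zero.symm
  · refine (Homotopy.ofEq ?_).trans (((null.compLeft i).compRight e).trans (.ofEq ?_))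
    · simp [← e_i, i_e]
    · simp

theorem IsPureInjectiveResolution.comp_fst {Y I₁ I₂ : CochainComplex (ModuleCat.{v} R) ℤ}
    {f : Y ⟶ I} (hf : IsPureInjectiveResolution f) (e : I ≅ I₁ ⊞ I₂) (h₂ : Contractible I₂) :
    IsPureInjectiveResolution (f ≫ e.hom ≫ biprod.fst) := by
  obtain ⟨trW_f, pureInjective, orth⟩ := isPureInjectiveResolution_iff.1 hf
  have I₂_zero : IsZero ((toK R).obj I₂) := HomotopyCategory.isZero_quotient_obj_iff _ |>.2 h₂
  have : IsIso ((toK R).map (biprod.fst : I₁ ⊞ I₂ ⟶ I₁)) := by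
    refine ⟨(toK R).map biprod.inl, ?_, ?_⟩
    · have snd_zero : (toK R).map (biprod.snd : I₁ ⊞ I₂ ⟶ I₂) = 0 := I₂_zero.eq_of_tgt _ _
      rw [← Functor.map_comp, ← CategoryTheory.Functor.map_id, ← biprod.total, Functor.map_add,
        Functor.map_comp _ biprod.snd, snd_zero, zero_comp, add_zero]
    · rw [← Functor.map_comp, biprod.inl_fst, CategoryTheory.Functor.map_id]
  have : IsIso ((toK R).map (e.hom ≫ biprod.fst)) := by
    rw [Functor.map_comp]
    infer_instance
  refine isPureInjectiveResolution_iff.2 ⟨?_, fun i => ?_, ?_⟩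
  · rw [Functor.map_comp]
    exact (MorphismProperty.cancel_right_of_respectsIso _ _ _).2 trW_f
  · refine (pureInjective i).of_retract ((biprod.inl ≫ e.inv).f i).hom
      ((e.hom ≫ biprod.fst).f i).hom ?_
    have retract : (biprod.inl ≫ e.inv) ≫ e.hom ≫ biprod.fst = 𝟙 I₁ := by simp
    exact congrArg ModuleCat.Hom.hom (HomologicalComplex.congr_hom retract i)
  · exact (pureAcyclic R).rightOrthogonal.prop_of_iso
      (asIso ((toK R).map (e.hom ≫ biprod.fst))) orth

end Decomposition

section Truncation

variable {R : Type w} [Ring R] {X : CochainComplex (ModuleCat.{v} R) ℤ} {a : ℤ}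

theorem isIso_πTruncGE_f {j : ℤ} (hj : a < j) : IsIso ((X.πTruncGE a).f j) := by
  obtain ⟨k, rfl⟩ := Int.le.dest hj.le
  refine (ComplexShape.Embedding.isIso_liftExtend_f_iff (ComplexShape.embeddingUpIntGE a) _
    (X.restrictionToTruncGE'_hasLift _) rfl).2 (X.isIso_restrictionToTruncGE' _ _ ?_)
  rw [ComplexShape.boundaryGE_embeddingUpIntGE_iff]
  lia

theorem exists_πTruncGE_f_comp {E : ModuleCat.{v} R} {i j : ℤ} (hij : i + 1 = j) (hj : a ≤ j)
    (α : X.X j ⟶ E) (hα : j = a → X.d i j ≫ α = 0) : ∃ γ, (X.πTruncGE a).f j ≫ γ = α := by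
  rcases hj.lt_or_eq with hj | rfl
  · have := isIso_πTruncGE_f (X := X) hj
    exact ⟨inv ((X.πTruncGE a).f j) ≫ α, IsIso.hom_inv_id_assoc _ _⟩
  · let φ : X ⟶ (HomologicalComplex.single (ModuleCat.{v} R) (ComplexShape.up ℤ) a).obj E :=
      HomologicalComplex.mkHomToSingle α fun l hl => by
        obtain rfl : l = i := by have : l + 1 = a := hl; lia
        exact hα rfl
    refine ⟨(CochainComplex.truncGEMap φ a ≫ inv (CochainComplex.πTruncGE _ a)).f a ≫
      (HomologicalComplex.singleObjXSelf _ a E).hom, ?_⟩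
    rw [← HomologicalComplex.comp_f_assoc, CochainComplex.πTruncGE_naturality_assoc,
      IsIso.hom_inv_id, Category.comp_id]
    simp [φ]

theorem pureQuasiIso_πTruncGE (hX : ∀ j < a, PureExactAt X j) : PureQuasiIso (X.πTruncGE a) := by
  refine pureQuasiIso_of_exists_factor fun E hE _ i j k _ hij hjk α κ _ hκ => ?_
  have comp_eq_zero (hi : i < a) : X.d i j ≫ α = 0 := by
    rw [← hκ, (CochainComplex.isZero_of_isStrictlyGE _ a i hi).eq_of_src κ 0, comp_zero]
  rcases lt_or_ge j a with hj | hj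
  · obtain ⟨ψ, hψ⟩ := (hX j hj).exists_factor hE hij hjk α (comp_eq_zero (by lia))
    exact ⟨-ψ, 0, by simp [hψ], (CochainComplex.isZero_of_isStrictlyGE _ a i).eq_of_src _ _⟩
  · obtain ⟨γ, hγ⟩ := exists_πTruncGE_f_comp hij hj α fun hja => comp_eq_zero (by lia)
    have : Epi ((X.πTruncGE a).f i) :=
      inferInstanceAs (Epi ((HomologicalComplex.πTruncGE _ _).f i))
    refine ⟨0, γ, by simp [hγ], (cancel_epi ((X.πTruncGE a).f i)).1 ?_⟩
    rw [hκ, HomologicalComplex.Hom.comm_assoc, hγ]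

end Truncation

section Pext

open CochainComplex.HomComplex

variable {R : Type w} [Ring R] {X Y I : CochainComplex (ModuleCat.{v} R) ℤ}

theorem IsPureInjectiveResolution.isZero_pext_iff {f : Y ⟶ I}
    (hf : IsPureInjectiveResolution f) {i : ℤ} :
    IsZero (Pext i X Y) ↔ coboundaries X I i = ⊤ := by
  obtain ⟨g, hg⟩ := hf.exists_chosenResolution
  obtain ⟨e⟩ := hg.nonempty_iso hf
  let e' := (CategoryTheory.shiftFunctor _ i).mapIso e
  refine isZero_homology_homComplex_iff.trans ?_
  rw [coboundaries_eq_top_iff, coboundaries_eq_top_iff]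
  exact ⟨fun h f => (cancel_mono e'.inv).1 ((h _).trans zero_comp.symm),
    fun h f => (cancel_mono e'.hom).1 ((h _).trans zero_comp.symm)⟩

theorem coboundaries_eq_top_of_isStrictlyGE {a n i : ℤ} [X.IsStrictlyGE a]
    (hI : ∀ j, n < j → IsZero (I.X j)) (h : n < a + i) : coboundaries X I i = ⊤ := by
  refine eq_top_iff.2 fun z _ => ?_
  suffices z = 0 from this ▸ zero_mem _
  refine Cocycle.ext <| Cochain.ext _ _ fun p q hpq => ?_
  rcases lt_or_ge p a with hp | hp
  · exact (X.isZero_of_isStrictlyGE a p hp).eq_of_src _ _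
  · exact (hI q (by lia)).eq_of_tgt _ _

theorem IsPureInjectiveResolution.coboundaries_eq_top {f : Y ⟶ I}
    (hf : IsPureInjectiveResolution f) {n i : ℤ} (hI : ∀ j, n < j → IsZero (I.X j))
    (hX : ∀ j ≤ n - i, PureExactAt X j) : coboundaries X I i = ⊤ := by
  obtain ⟨-, -, orth⟩ := isPureInjectiveResolution_iff.1 hf
  have quasiIso : PureQuasiIso (X.πTruncGE (n - i + 1)) :=
    pureQuasiIso_πTruncGE fun j hj => hX j (by lia)
  rw [coboundaries_eq_top_iff]
  intro z
  obtain ⟨g, rfl⟩ := (bijective_map_comp quasiIso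
    ((pureAcyclic R).rightOrthogonal.le_shift i _ orth)).2 z
  rw [coboundaries_eq_top_iff.1 (coboundaries_eq_top_of_isStrictlyGE (a := n - i + 1) hI
    (by lia)) g]
  exact comp_zero

theorem exists_comp_d_eq_of_coboundaries_eq_top {M : ModuleCat.{v} R} {i j k : ℤ}
    (hij : i + 1 = j) (hjk : j + 1 = k) (h : coboundaries (stalk M) I j = ⊤) (φ : M ⟶ I.X j)
    (hφ : φ ≫ I.d j k = 0) : ∃ ψ : M ⟶ I.X i, ψ ≫ I.d i j = φ :=
  (Cocycle.fromSingleMk_mem_coboundaries_iff φ (zero_add j) k hjk hφ i hij).1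
    (h ▸ AddSubgroup.mem_top _)

theorem exists_section_toCycles {i j k : ℤ} (hij : i + 1 = j) (hjk : j + 1 = k)
    (h : ∀ M : ModuleCat.{v} R, coboundaries (stalk M) I j = ⊤) :
    ∃ s, toCycles I i j k ∘ₗ s = LinearMap.id := by
  obtain ⟨s, hs⟩ := exists_comp_d_eq_of_coboundaries_eq_top hij hjk (h _)
    (ModuleCat.ofHom (LinearMap.ker (I.d j k).hom).subtype)
    (ModuleCat.hom_ext <| LinearMap.ext fun z => z.2)
  exact ⟨s.hom, LinearMap.ext fun z => Subtype.ext congr($hs z)⟩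

theorem pureExactAt_stalk (M : ModuleCat.{v} R) {j : ℤ} (hj : j ≠ 0) :
    PureExactAt (stalk M) j :=
  pureExactAt_of_isZero (HomologicalComplex.isZero_single_obj_X _ _ _ _ hj)

end Pext

section Dimension

variable {R : Type w} [Ring R] {Y I : CochainComplex (ModuleCat.{v} R) ℤ} {f : Y ⟶ I} {n : ℤ}

theorem IsPureInjectiveResolution.hasResolutionUpTo (hf : IsPureInjectiveResolution f)
    (h : SplitAbove I n) : HasResolutionUpTo Y n := by
  obtain ⟨I₁, I₂, ⟨e⟩, hI₁, hI₂⟩ := h.exists_iso_biprod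
  exact ⟨I₁, _, hf.comp_fst e hI₂, hI₁⟩

theorem HasResolutionUpTo.splitAbove (h : HasResolutionUpTo Y n)
    (hf : IsPureInjectiveResolution f) : SplitAbove I n := by
  obtain ⟨J, g, hg, hJ⟩ := h
  obtain ⟨e⟩ := hf.nonempty_iso hg
  exact (splitAbove_of_isZero hJ).of_iso e

theorem HasResolutionUpTo.isZero_pext (h : HasResolutionUpTo Y n)
    {X : CochainComplex (ModuleCat.{v} R) ℤ} {i : ℤ} (hX : ∀ j ≤ n - i, PureExactAt X j) :
    IsZero (Pext i X Y) := by
  obtain ⟨J, g, hg, hJ⟩ := h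
  exact hg.isZero_pext_iff.2 (hg.coboundaries_eq_top hJ hX)

theorem IsPureInjectiveResolution.exists_section_of_isZero_pext
    (hf : IsPureInjectiveResolution f) {i j k : ℤ} (hij : i + 1 = j) (hjk : j + 1 = k)
    (h : ∀ M : ModuleCat.{v} R, IsZero (Pext j (stalk M) Y)) :
    ∃ s, toCycles I i j k ∘ₗ s = LinearMap.id :=
  exists_section_toCycles hij hjk fun M => hf.isZero_pext_iff.1 (h M)

end Dimension

end PureDerived

end

open PureDerived in
theorem theorem4p6_general {R : Type w} [Ring R] {Y I : CochainComplex (ModuleCat.{v} R) ℤ}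
    {f : Y ⟶ I} (hf : IsPureInjectiveResolution f) (n : ℤ) :
    List.TFAE [
      pid Y ≤ ext n,
      supp Y ≤ ext n ∧
        ∀ (I' : CochainComplex (ModuleCat.{v} R) ℤ) (f' : Y ⟶ I'),
          IsPureInjectiveResolution f' →
            PureInjective R (LinearMap.ker (I'.d n (n + 1)).hom),
      ∀ (I' : CochainComplex (ModuleCat.{v} R) ℤ) (f' : Y ⟶ I'),
        IsPureInjectiveResolution f' →
          ∃ I₁ I₂ : CochainComplex (ModuleCat.{v} R) ℤ, Nonempty (I' ≅ I₁ ⊞ I₂) ∧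
            (∀ i : ℤ, n < i → IsZero (I₁.X i)) ∧ Contractible I₂,
      ∀ (X : CochainComplex (ModuleCat.{v} R) ℤ) (i : ℤ),
        ext n - infp X < ext i → IsZero (Pext i X Y),
      supp Y ≤ ext n ∧
        ∀ M : ModuleCat.{v} R, IsZero (Pext (n + 1) (stalk M) Y)] := by
  simp only [pid_le_iff, supp_le_iff, ext_sub_infp_lt_iff, hf.pureQuasiIso.pureTail_iff]
  tfae_have 1 → 2 := fun h => ⟨(h.splitAbove hf).pureTail, fun _ _ hf' =>
    (h.splitAbove hf').pureInjective_ker (hf'.pureInjective n)⟩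
  tfae_have 2 → 1 := fun ⟨hI, hker⟩ => hf.hasResolutionUpTo
    (hI.splitAbove hf.pureInjective (hker I f hf))
  tfae_have 1 → 3 := fun h _ _ hf' => (h.splitAbove hf').exists_iso_biprod
  tfae_have 3 → 1 := fun h =>
    have ⟨I₁, _, ⟨e⟩, hI₁, hI₂⟩ := h I f hf
    ⟨I₁, _, hf.comp_fst e hI₂, hI₁⟩
  tfae_have 1 → 4 := fun h _ _ hX => h.isZero_pext hX
  tfae_have 4 → 1 := fun h => hf.hasResolutionUpTo fun i j k hi hij hjk =>
    hf.exists_section_of_isZero_pext hij hjk fun M =>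
      h _ j fun l hl => pureExactAt_stalk M (by lia)
  tfae_have 1 → 5 := fun h => ⟨(h.splitAbove hf).pureTail, fun M =>
    h.isZero_pext fun j hj => pureExactAt_stalk M (by lia)⟩
  tfae_have 5 → 1 := fun ⟨hI, h⟩ => by
    obtain ⟨s, hs⟩ := hf.exists_section_of_isZero_pext rfl rfl h
    have hker : PureInjective R (LinearMap.ker (I.d n (n + 1)).hom) :=
      ker_toCycles (X := I) n _ _ ▸ (hf.pureInjective n).ker_of_section s hs
    exact hf.hasResolutionUpTo (hI.splitAbove hf.pureInjective hker)
  tfae_finish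

theorem theorem4p6 {R : Type u} [Ring R] (Y : CochainComplex (ModuleCat.{u} R) ℤ)
    (hY : PureDerived.InDbpur Y) (n : ℤ) :
    List.TFAE [
      PureDerived.pid Y ≤ PureDerived.ext n,
      PureDerived.supp Y ≤ PureDerived.ext n ∧
        ∀ (I' : CochainComplex (ModuleCat.{u} R) ℤ) (f' : Y ⟶ I'),
          PureDerived.IsPureInjectiveResolution f' →
            PureDerived.PureInjective R (LinearMap.ker (I'.d n (n + 1)).hom),
      ∀ (I' : CochainComplex (ModuleCat.{u} R) ℤ) (f' : Y ⟶ I'),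
        PureDerived.IsPureInjectiveResolution f' →
          ∃ I₁ I₂ : CochainComplex (ModuleCat.{u} R) ℤ, Nonempty (I' ≅ I₁ ⊞ I₂) ∧
            (∀ i : ℤ, n < i → IsZero (I₁.X i)) ∧ PureDerived.Contractible I₂,
      ∀ (X : CochainComplex (ModuleCat.{u} R) ℤ) (i : ℤ),
        PureDerived.ext n - PureDerived.infp X < PureDerived.ext i →
          IsZero (PureDerived.Pext i X Y),
      PureDerived.supp Y ≤ PureDerived.ext n ∧
        ∀ M : ModuleCat.{u} R, IsZero (PureDerived.Pext (n + 1) (PureDerived.stalk M) Y)] := by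
  obtain ⟨I, f, hf⟩ := PureDerived.exists_resolution hY
  exact theorem4p6_general hf n
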